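/- Let $\Sigma$ be a finite alphabet and $\mathcal D$ an infinite set of data values. A data word is a finite sequence $w=(a_1,d_1)\cdots(a_n,d_n)$ over $\Sigma\times\mathcal D$. For positions $i,j$ write $i\sim j$ if $d_i=d_j$, and call $j$ the class successor of $i$ if $i<j$, $i\sim j$ and no position $k$ with $i<k<j$ satisfies $k\sim i$. For a regular language $L\subseteq\Sigma^*$, the guarded regular predicate $\widetilde L(i,j)$ holds if $i\sim j$, $i<j$ and $a_{i+1}\cdots a_{j-1}\in L$. For a finite family $\mathcal F$ of regular languages over $\Sigma$, let $\mathrm{EMSO}^2[\widetilde{\mathcal F}]$ be the set of sentences $\exists X_1\cdots\exists X_n\,\varphi$, where $X_1,\dots,X_n$ range over sets of positions and $\varphi$ is a first-order formula, interpreted over the positions of a data word, that uses only the two variables $x,y$, the unary predicates $X_1,\dots,X_n$ and $c(x)$ ("$x$ is labelled $c$") for $c\in\Sigma$, the binary predicates $=$, $<$, $y=x+1$, $\sim$, "$y$ is the class successor of $x$", and $\widetilde L(x,y)$ for $L\in\mathcal F$. A sentence is satisfiable if it holds in some data word over $\Sigma$ and $\mathcal D$. **Proposition.** For every fixed finite alphabet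 $\Sigma$ and infinite set $\mathcal D$, the problem whether a given sentence of $\mathrm{EMSO}^2[\widetilde{\mathcal F}]$ is satisfiable is undecidable in each of the following cases: 1. $\mathcal F=\{\Sigma^*a\Sigma^*,\ \Sigma^*b\Sigma^*\}$, where $a,b\in\Sigma$ are distinct and $\Sigma$ contains a letter other than $a$ and $b$; 2. $\mathcal F=\{(\Sigma\setminus\{a\})^*\,a\,(\Sigma\setminus\{a\})^*\}$, where $a\in\Sigma$ and $\Sigma$ contains a letter other than $a$. -/

import Mathlib

namespace DataWord

open scoped Computability

/-- The words of length one whose letter belongs to `S`. -/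
def letters {A : Type*} (S : Set A) : Language A := {u | ∃ c ∈ S, u = [c]}

/-- The regular language `Σ* a Σ*`. -/
def withLetter {A : Type*} (a : A) : Language A :=
  (letters Set.univ)∗ * letters {a} * (letters Set.univ)∗

/-- The regular language `(Σ ∖ a)* a (Σ ∖ a)*`. -/
def withLetterOnce {A : Type*} (a : A) : Language A :=
  (letters {a}ᶜ)∗ * letters {a} * (letters {a}ᶜ)∗

/-! ### Data words

A data word over the alphabet `A` and the data domain `D` is a list of pairs `(a, d)`;
its positions are `0, …, w.length - 1`. -/

section Words

variable {A : Type*} {D : Type*}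

/-- Position `i` of `w` is labelled by the letter `a`. -/
def HasLabel (w : List (A × D)) (a : A) (i : ℕ) : Prop := w[i]?.map Prod.fst = some a

/-- `i ∼ j`: the positions `i` and `j` of `w` carry the same data value. -/
def SameClass (w : List (A × D)) (i j : ℕ) : Prop :=
  ∃ d : D, w[i]?.map Prod.snd = some d ∧ w[j]?.map Prod.snd = some d

/-- `j` is the class successor of `i`: the next position of `w` that is in the class of `i`. -/
def ClassSucc (w : List (A × D)) (i j : ℕ) : Prop :=
  SameClass w i j ∧ i < j ∧ ∀ k, i < k → k < j → ¬ SameClass w i k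

/-- The string projection of the factor of `w` strictly between the positions `i` and `j`. -/
def factor (w : List (A × D)) (i j : ℕ) : List A := ((w.take j).drop (i + 1)).map Prod.fst

/-- The regular predicate `L(i, j)`. -/
def RegPred (w : List (A × D)) (L : Language A) (i j : ℕ) : Prop :=
  i < j ∧ factor w i j ∈ L

/-- The guarded regular predicate, `i ∼ j ∧ L(i, j)`. -/
def GuardedPred (w : List (A × D)) (L : Language A) (i j : ℕ) : Prop :=
  SameClass w i j ∧ RegPred w L i j

end Words

/-! ### The logic -/

/-- The two first-order variables: `0` is `x` and `1` is `y`. -/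
abbrev Var := Fin 2

/-- Two-variable first-order formulas over the letters of `A`, the monadic predicates
`X_0, …, X_{n-1}`, equality, `<`, `+1`, `∼`, the class successor, and symbols for `m` guarded
regular predicates. The remaining connectives and `∀` are definable as usual. -/
inductive FO2 (A : Type*) (m n : ℕ)
  | letter (a : A) (u : Var)
  | inSet (i : Fin n) (u : Var)
  | eq (u v : Var)
  | lt (u v : Var)
  | succ (u v : Var)
  | sim (u v : Var)
  | classSucc (u v : Var)
  | guarded (i : Fin m) (u v : Var)
  | neg (φ : FO2 A m n)
  | and (φ ψ : FO2 A m n)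
  | ex (u : Var) (φ : FO2 A m n)

namespace FO2

variable {A : Type*} {D : Type*} {m n : ℕ}

/-- The free first-order variables of a formula. -/
def free : FO2 A m n → Set Var
  | letter _ u => {u}
  | inSet _ u => {u}
  | eq u v => {u, v}
  | lt u v => {u, v}
  | succ u v => {u, v}
  | sim u v => {u, v}
  | classSucc u v => {u, v}
  | guarded _ u v => {u, v}
  | neg φ => φ.free
  | and φ ψ => φ.free ∪ ψ.free
  | ex u φ => φ.free \ {u}

/-- `φ.Holds F w X s`: the data word `w` satisfies `φ`, where the `i`-th guarded predicate symbol
is given by the language `F i`, the set variables by `X`, and the first-order variables by the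
positions `s`. -/
def Holds (F : Fin m → Language A) (w : List (A × D)) (X : Fin n → Set ℕ) :
    FO2 A m n → (Var → ℕ) → Prop
  | letter a u, s => HasLabel w a (s u)
  | inSet i u, s => s u ∈ X i
  | eq u v, s => s u = s v
  | lt u v, s => s u < s v
  | succ u v, s => s v = s u + 1
  | sim u v, s => SameClass w (s u) (s v)
  | classSucc u v, s => ClassSucc w (s u) (s v)
  | guarded i u v, s => GuardedPred w (F i) (s u) (s v)
  | neg φ, s => ¬ φ.Holds F w X s
  | and φ ψ, s => φ.Holds F w X s ∧ ψ.Holds F w X s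
  | ex u φ, s => ∃ p < w.length, φ.Holds F w X (Function.update s u p)

/-- Truth of a formula depends only on the values of its free variables. -/
theorem holds_congr (F : Fin m → Language A) (w : List (A × D)) (X : Fin n → Set ℕ)
    (φ : FO2 A m n) (s t : Var → ℕ) (h : ∀ u ∈ φ.free, s u = t u) :
    φ.Holds F w X s ↔ φ.Holds F w X t := by
  induction φ generalizing s t with
  | neg φ ih => exact not_congr (ih s t h)
  | and φ ψ ih₁ ih₂ =>
    exact and_congr (ih₁ s t fun u hu => h u (Or.inl hu)) (ih₂ s t fun u hu => h u (Or.inr hu))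
  | ex u φ ih =>
    refine exists_congr fun p => and_congr_right fun _ => ih _ _ fun v hv => ?_
    by_cases hvu : v = u
    · subst hvu; simp
    · simpa [Function.update, hvu] using h v ⟨hv, hvu⟩
  | _ => simp_all [Holds, free]

/-- A Gödel numbering of the formulas. -/
def code [Encodable A] : FO2 A m n → ℕ
  | letter a u => Nat.pair 0 (Nat.pair (Encodable.encode a) u)
  | inSet i u => Nat.pair 1 (Nat.pair i u)
  | eq u v => Nat.pair 2 (Nat.pair u v)
  | lt u v => Nat.pair 3 (Nat.pair u v)
  | succ u v => Nat.pair 4 (Nat.pair u v)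
  | sim u v => Nat.pair 5 (Nat.pair u v)
  | classSucc u v => Nat.pair 6 (Nat.pair u v)
  | guarded i u v => Nat.pair 7 (Nat.pair i (Nat.pair u v))
  | neg φ => Nat.pair 8 φ.code
  | and φ ψ => Nat.pair 9 (Nat.pair φ.code ψ.code)
  | ex u φ => Nat.pair 10 (Nat.pair u φ.code)

theorem code_injective [Encodable A] : Function.Injective (code : FO2 A m n → ℕ) := by
  intro φ
  induction φ with
  | neg φ ih =>
    intro χ h
    cases χ <;> simp [code, Nat.pair_eq_pair] at h
    rw [ih h]
  | and φ ψ ih₁ ih₂ =>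
    intro χ h
    cases χ <;> simp [code, Nat.pair_eq_pair] at h
    rw [ih₁ h.1, ih₂ h.2]
  | ex u φ ih =>
    intro χ h
    cases χ <;> simp [code, Nat.pair_eq_pair, Fin.val_inj] at h
    rw [h.1, ih h.2]
  | _ =>
    intro χ h
    cases χ <;> simp [code, Nat.pair_eq_pair, Fin.val_inj] at h
    simp [h]

end FO2

/-- A sentence `∃ X_0 … ∃ X_{n-1} φ` of EMSO² with letters in `A` and `m` guarded predicate
symbols. -/
structure EMSO2 (A : Type*) (m : ℕ) where
  /-- the number of quantified set variables -/
  n : ℕ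
  /-- the two-variable first-order part -/
  matrix : FO2 A m n
  closed : matrix.free = ∅

namespace EMSO2

variable {A : Type*} {m : ℕ}

/-- The data word `w` is a model of `ψ`. As the matrix is closed, the initial valuation of the
first-order variables does not matter. -/
def Models {D : Type*} (F : Fin m → Language A) (w : List (A × D)) (ψ : EMSO2 A m) : Prop :=
  ∃ X : Fin ψ.n → Set ℕ, (∀ i, ∀ p ∈ X i, p < w.length) ∧ ψ.matrix.Holds F w X (fun _ => 0)

/-- Some data word with data values in `D` is a model of `ψ`. -/
def Satisfiable (D : Type*) (F : Fin m → Language A) (ψ : EMSO2 A m) : Prop :=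
  ∃ w : List (A × D), ψ.Models F w

/-- A Gödel numbering of the sentences. -/
def code [Encodable A] (ψ : EMSO2 A m) : ℕ := Nat.pair ψ.n ψ.matrix.code

theorem code_injective [Encodable A] : Function.Injective (code : EMSO2 A m → ℕ) := by
  rintro ⟨n, φ, hφ⟩ ⟨k, χ, hχ⟩ h
  obtain ⟨h₁, h₂⟩ := Nat.pair_eq_pair.1 h
  dsimp only at h₁ h₂
  subst h₁
  obtain rfl := FO2.code_injective h₂
  rfl

/-- A property of sentences is decidable if some computable function decides it, given the code
of a sentence. -/
def IsDecidable [Encodable A] (P : EMSO2 A m → Prop) : Prop :=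
  ∃ f : ℕ → Bool, Computable f ∧ ∀ ψ : EMSO2 A m, f ψ.code = true ↔ P ψ

end EMSO2

end DataWord

/-! The halting problem is reduced to satisfiability by way of counter machines with zero tests. A
machine is a regular language of instructions. Such programs compute all primitive recursive
functions (`IsProgram.exists_computes`), so a program that guesses `k` and verifies `g n k = 0` can
reach the empty configuration from the input `n` exactly if `n` lies in an undecidable set
(`exists_language_undecidable`).

A run is written as a data word that separators cut into blocks: an initial block for the input,
then one block per instruction. A unit stored in a register is a position, and its copies in
successive blocks share a data value. Everything rests on one relation: same class, with exactly one
separator in between. If class successors are always so related, a class meets each block at most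
once. If moreover every outgoing unit has a partner in the next block and every incoming unit one in
the preceding block, equality of data values is a bijection between them. Counters are then passed
on without loss or gain, and zero tests are exact (`Valid.run`). Conversely, a terminating execution
yields such a word when every new unit gets a fresh name (`exists_valid`).

States, instructions and roles of positions are guessed by the set variables, so the alphabet only
has to mark separators (`not_isDecidable_of_oneSep`). For the language with exactly one `a`,
separators carry `a` and the relation is the guarded predicate itself. For the other pair of
languages, separators carry `a` and `b` alternately. Two or more successive separators then include
both letters, so exactly one separator lies in between iff exactly one of the two guarded predicates
holds. The formula is fixed; the input `n` enters only through a sentence that speaks about position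
`n + 2` and whose code is computable from `n` (`not_isDecidable_satisfiable`). -/

namespace Language

/-! ### Closure properties of regular languages, by finiteness of the set of left quotients. -/

open scoped Computability

variable {α : Type*}

/-- The quotient of `L * M` by `x` is `(x⁻¹L) * M` together with all `z⁻¹M` for which `x = p ++ z`
and `p ∈ L`. It is determined by one quotient of `L` and a set of quotients of `M`, which leaves
finitely many possibilities. -/
theorem IsRegular.mul {L M : Language α} (hL : L.IsRegular) (hM : M.IsRegular) :
    (L * M).IsRegular := by
  rw [isRegular_iff_finite_range_leftQuotient] at *
  refine ((hL.prod hM.finite_subsets).image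
    fun p : Language α × Set (Language α) => p.1 * M + sSup p.2).subset ?_
  rintro _ ⟨x, rfl⟩
  refine ⟨(L.leftQuotient x, {Q | ∃ p ∈ L, ∃ z, x = p ++ z ∧ Q = M.leftQuotient z}),
    ⟨⟨x, rfl⟩, ?_⟩, ?_⟩
  · rintro _ ⟨p, _, z, _, rfl⟩
    exact ⟨z, rfl⟩
  ext y
  constructor
  · rintro (⟨a, ha, b, hb, rfl⟩ | ⟨_, ⟨p, hp, z, rfl, rfl⟩, hy⟩)
    · exact ⟨x ++ a, ha, b, hb, by simp⟩
    · exact ⟨p, hp, z ++ y, hy, by simp⟩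
  · rintro ⟨a, ha, b, hb, hab⟩
    rcases List.append_eq_append_iff.1 hab with ⟨c, h₁, h₂⟩ | ⟨c, h₁, h₂⟩
    · exact Or.inr ⟨_, ⟨a, ha, c, h₁, rfl⟩, by rw [h₂] at hb; exact hb⟩
    · exact Or.inl ⟨c, by rw [h₁] at ha; exact ha, b, hb, h₂.symm⟩

/-- The end of `x` falls into, or at the end of, some factor from `L`: `z` is the part of that
factor inside `x`, and `p` collects the factors before it. For `x = []` there need not be any
factor. -/
theorem exists_append_of_append_mem_kstar {L : Language α} {x y : List α} (hx : x ≠ [])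
    (h : x ++ y ∈ L∗) :
    ∃ p ∈ L∗, ∃ z, x = p ++ z ∧ y ∈ L.leftQuotient z * L∗ := by
  obtain ⟨S, hS, hL⟩ := mem_kstar.1 h
  clear h
  induction S generalizing x with
  | nil => simp [hx] at hS
  | cons s S ih =>
    rw [List.flatten_cons] at hS
    have hS' : S.flatten ∈ L∗ := ⟨S, rfl, fun t ht => hL t (List.mem_cons_of_mem _ ht)⟩
    have hs := hL s List.mem_cons_self
    rcases List.append_eq_append_iff.1 hS with ⟨c, h₁, h₂⟩ | ⟨c, h₁, h₂⟩
    · refine ⟨[], nil_mem_kstar L, x, rfl, c, ?_, _, hS', h₂.symm⟩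
      exact (show x ++ c ∈ L by rwa [← h₁])
    · by_cases hc : c = []
      · subst hc
        refine ⟨[], nil_mem_kstar L, x, rfl, [], ?_, y, ?_, rfl⟩
        · rw [List.append_nil] at h₁
          exact (show x ++ [] ∈ L by rwa [List.append_nil, h₁])
        · rwa [h₂] at hS'
      · obtain ⟨p, hp, z, rfl, hy⟩ := ih hc h₂.symm fun t ht => hL t (List.mem_cons_of_mem _ ht)
        refine ⟨s ++ p, ?_, z, by simp [h₁], hy⟩
        rw [← one_add_self_mul_kstar_eq_kstar]
        exact Or.inr ⟨s, hs, p, hp, rfl⟩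

/-- For `x ≠ []` the quotient of `L∗` by `x` is a union of languages `Q * L∗` with `Q` a quotient of
`L`; for `x = []` it is `L∗`. -/
theorem IsRegular.kstar {L : Language α} (hL : L.IsRegular) : (L∗).IsRegular := by
  rw [isRegular_iff_finite_range_leftQuotient] at *
  refine ((hL.finite_subsets.image
    fun T : Set (Language α) => sSup ((· * L∗) '' T)).insert (L∗)).subset ?_
  rintro _ ⟨x, rfl⟩
  by_cases hx : x = []
  · exact Or.inl (by rw [hx, leftQuotient_nil])
  refine Or.inr ⟨{Q | ∃ p ∈ L∗, ∃ z, x = p ++ z ∧ Q = L.leftQuotient z}, ?_, ?_⟩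
  · rintro _ ⟨p, _, z, _, rfl⟩
    exact ⟨z, rfl⟩
  ext y
  constructor
  · rintro ⟨_, ⟨_, ⟨p, hp, z, rfl, rfl⟩, rfl⟩, a, ha, b, hb, rfl⟩
    rw [mem_leftQuotient, ← kstar_mul_kstar]
    refine ⟨p, hp, z ++ (a ++ b), ?_, by simp⟩
    rw [← one_add_self_mul_kstar_eq_kstar]
    exact Or.inr ⟨z ++ a, ha, b, hb, by simp⟩
  · intro h
    obtain ⟨p, hp, z, hxz, hy⟩ := exists_append_of_append_mem_kstar hx h
    exact ⟨_, ⟨_, ⟨p, hp, z, hxz, rfl⟩, rfl⟩, hy⟩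

theorem IsRegular.of_finite {L : Language α} (hL : Set.Finite (L : Set (List α))) :
    L.IsRegular := by
  rw [isRegular_iff_finite_range_leftQuotient]
  have h : (⋃ u ∈ (L : Set (List α)), {z | z <:+ u}).Finite :=
    hL.biUnion fun u _ => (List.finite_toSet u.tails).subset fun z hz => by simpa using hz
  refine h.finite_subsets.subset ?_
  rintro _ ⟨x, rfl⟩ y hy
  exact Set.mem_biUnion (x := x ++ y) hy (List.suffix_append x y)

end Language

namespace DataWord

open scoped Computability

/-! ### Counter programs -/

/-- Instructions of a counter machine with registers in `R`. -/
inductive Instr (R : Type*)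
  | inc (r : R)
  | dec (r : R)
  | zero (r : R)

namespace Instr

variable {R S : Type*}

/-- The register of an instruction. -/
def reg : Instr R → R
  | inc r => r
  | dec r => r
  | zero r => r

/-- Renaming of registers. -/
def map (f : R → S) : Instr R → Instr S
  | inc r => inc (f r)
  | dec r => dec (f r)
  | zero r => zero (f r)

instance [Finite R] : Finite (Instr R) := by
  refine Finite.of_injective (β := R ⊕ R ⊕ R) (fun
    | inc r => Sum.inl r
    | dec r => Sum.inr (Sum.inl r)
    | zero r => Sum.inr (Sum.inr r)) ?_
  rintro (r | r | r) (s | s | s) h <;> simp_all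

/-- The effect of an instruction on the contents of the registers. -/
def Step [DecidableEq R] : Instr R → (R → ℕ) → (R → ℕ) → Prop
  | inc r, σ, τ => τ = Function.update σ r (σ r + 1)
  | dec r, σ, τ => σ = Function.update τ r (τ r + 1)
  | zero r, σ, τ => σ r = 0 ∧ τ = σ

end Instr

/-- The effect of a sequence of instructions. -/
def Exec {R : Type*} [DecidableEq R] : List (Instr R) → (R → ℕ) → (R → ℕ) → Prop
  | [], σ, τ => σ = τ
  | i :: u, σ, τ => ∃ μ, i.Step σ μ ∧ Exec u μ τ

/-- Some sequence of instructions in `L` leads from `σ` to `τ`. -/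
def Run {R : Type*} [DecidableEq R] (L : Language (Instr R)) (σ τ : R → ℕ) : Prop :=
  ∃ u ∈ L, Exec u σ τ

section Run

variable {R : Type*} [DecidableEq R]

theorem exec_append {u v : List (Instr R)} {σ τ : R → ℕ} :
    Exec (u ++ v) σ τ ↔ ∃ μ, Exec u σ μ ∧ Exec v μ τ := by
  induction u generalizing σ with
  | nil => simp [Exec]
  | cons i u ih =>
    simp only [List.cons_append, Exec, ih]
    constructor
    · rintro ⟨μ, h, ν, h₁, h₂⟩; exact ⟨ν, ⟨μ, h, h₁⟩, h₂⟩
    · rintro ⟨ν, ⟨μ, h, h₁⟩, h₂⟩; exact ⟨μ, h, ν, h₁, h₂⟩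

theorem run_one {σ τ : R → ℕ} : Run 1 σ τ ↔ τ = σ := by
  constructor
  · rintro ⟨u, rfl, h⟩; exact h.symm
  · rintro rfl; exact ⟨[], rfl, rfl⟩

theorem run_singleton {i : Instr R} {σ τ : R → ℕ} : Run {[i]} σ τ ↔ i.Step σ τ := by
  constructor
  · rintro ⟨u, rfl, μ, h, rfl⟩; exact h
  · intro h; exact ⟨[i], rfl, τ, h, rfl⟩

theorem run_mul {L M : Language (Instr R)} {σ τ : R → ℕ} :
    Run (L * M) σ τ ↔ ∃ μ, Run L σ μ ∧ Run M μ τ := by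
  constructor
  · rintro ⟨_, ⟨u, hu, v, hv, rfl⟩, h⟩
    obtain ⟨μ, h₁, h₂⟩ := exec_append.1 h
    exact ⟨μ, ⟨u, hu, h₁⟩, v, hv, h₂⟩
  · rintro ⟨μ, ⟨u, hu, h₁⟩, v, hv, h₂⟩
    exact ⟨u ++ v, ⟨u, hu, v, hv, rfl⟩, exec_append.2 ⟨μ, h₁, h₂⟩⟩

theorem run_kstar {L : Language (Instr R)} {σ τ : R → ℕ} :
    Run (L∗) σ τ ↔ Relation.ReflTransGen (Run L) σ τ := by
  constructor
  · rintro ⟨_, ⟨S, rfl, hS⟩, h⟩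
    induction S generalizing σ with
    | nil => cases h; exact .refl
    | cons s S ih =>
      obtain ⟨μ, h₁, h₂⟩ := exec_append.1 h
      exact .head ⟨s, hS s List.mem_cons_self, h₁⟩
        (ih (fun t ht => hS t (List.mem_cons_of_mem _ ht)) h₂)
  · intro h
    induction h using Relation.ReflTransGen.head_induction_on with
    | refl => exact ⟨[], Language.nil_mem_kstar L, rfl⟩
    | head h _ ih =>
      rw [← Language.one_add_self_mul_kstar_eq_kstar]
      obtain ⟨u, hu, h'⟩ := run_mul.2 ⟨_, h, ih⟩
      exact ⟨u, Or.inr hu, h'⟩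

/-- A loop that is left when the register `a` is empty. -/
theorem run_loop {B : Language (Instr R)} {a : R} {N : ℕ} {st : ℕ → R → ℕ}
    (hB : ∀ k < N, ∀ τ, Run B (st k) τ ↔ τ = st (k + 1)) (hN : ∀ τ, ¬ Run B (st N) τ)
    (ha : ∀ k ≤ N, st k a = 0 ↔ k = N) {τ : R → ℕ} :
    Run (B∗ * {[Instr.zero a]}) (st 0) τ ↔ τ = st N := by
  -- The body has a unique outcome on each `st k` with `k < N` and is blocked on `st N`, so
  -- iteration reaches exactly these states; the final zero test selects `k = N`.
  have key : ∀ μ, Relation.ReflTransGen (Run B) (st 0) μ ↔ ∃ k ≤ N, μ = st k := by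
    intro μ
    constructor
    · intro h
      induction h with
      | refl => exact ⟨0, Nat.zero_le _, rfl⟩
      | tail _ h ih =>
        obtain ⟨k, hk, rfl⟩ := ih
        rcases hk.lt_or_eq with hk | rfl
        · exact ⟨k + 1, hk, (hB k hk _).1 h⟩
        · exact absurd h (hN _)
    · rintro ⟨k, hk, rfl⟩
      induction k with
      | zero => exact .refl
      | succ k ih => exact (ih (by omega)).tail ((hB k hk _).2 rfl)
  rw [run_mul]
  simp only [run_kstar, run_singleton, key]
  constructor
  · rintro ⟨_, ⟨k, hk, rfl⟩, h, rfl⟩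
    rw [(ha k hk).1 h]
  · rintro rfl
    exact ⟨st N, ⟨N, le_rfl, rfl⟩, (ha N le_rfl).2 rfl, rfl⟩

end Run

/-- The regular languages of instructions that use finitely many registers. -/
def IsProgram (L : Language (Instr ℕ)) : Prop :=
  L.IsRegular ∧ ∃ K, ∀ u ∈ L, ∀ i ∈ u, i.reg < K

namespace IsProgram

variable {L M : Language (Instr ℕ)}

theorem one : IsProgram 1 :=
  ⟨.of_finite (Set.finite_singleton []), 0, by rintro u rfl; simp⟩

theorem singleton (i : Instr ℕ) : IsProgram {[i]} :=
  ⟨.of_finite (Set.finite_singleton [i]), i.reg + 1, by rintro u rfl; simp⟩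

theorem mul (hL : IsProgram L) (hM : IsProgram M) : IsProgram (L * M) := by
  obtain ⟨hL, K, hK⟩ := hL
  obtain ⟨hM, K', hK'⟩ := hM
  refine ⟨hL.mul hM, max K K', ?_⟩
  rintro _ ⟨u, hu, v, hv, rfl⟩ i hi
  rcases List.mem_append.1 hi with hi | hi
  · exact lt_max_of_lt_left (hK u hu i hi)
  · exact lt_max_of_lt_right (hK' v hv i hi)

theorem kstar (hL : IsProgram L) : IsProgram (L∗) := by
  obtain ⟨hL, K, hK⟩ := hL
  refine ⟨hL.kstar, K, ?_⟩
  rintro _ ⟨S, rfl, hS⟩ i hi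
  obtain ⟨u, hu, hi⟩ := List.mem_flatten.1 hi
  exact hK u (hS u hu) i hi

end IsProgram

open Function in
/-- `L` adds the value of `f` at the registers `ins` to the register `out`, if the registers from
`s` on are empty. -/
def Computes (L : Language (Instr ℕ)) {n : ℕ} (f : List.Vector ℕ n → ℕ) (ins : Fin n → ℕ)
    (out s : ℕ) : Prop :=
  ∀ σ : ℕ → ℕ, (∀ r, s ≤ r → σ r = 0) → ∀ τ,
    Run L σ τ ↔ τ = update σ out (σ out + f (.ofFn fun i => σ (ins i)))

/-! ### Counter programs for primitive recursive functions. -/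

namespace IsProgram

open Function

theorem exists_move {a b : ℕ} (hab : a ≠ b) : ∃ L, IsProgram L ∧ ∀ σ τ : ℕ → ℕ,
    Run L σ τ ↔ τ = update (update σ a 0) b (σ b + σ a) := by
  refine ⟨({[.dec a]} * {[.inc b]})∗ * {[.zero a]},
    (((singleton _).mul (singleton _)).kstar).mul (singleton _), fun σ τ => ?_⟩
  have := run_loop (B := {[.dec a]} * {[.inc b]}) (a := a) (N := σ a) (τ := τ)
    (st := fun k => update (update σ a (σ a - k)) b (σ b + k)) ?_ ?_ ?_
  · simpa using this
  · intro k hk τ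
    simp only [run_mul, run_singleton, Instr.Step]
    constructor
    · rintro ⟨μ, h, rfl⟩
      funext r
      have h₁ := congrFun h r
      have h₂ := congrFun h a
      have h₃ := congrFun h b
      simp only [update_apply] at *
      split_ifs at * <;> grind
    · rintro rfl
      refine ⟨update (update σ a (σ a - (k + 1))) b (σ b + k), ?_, ?_⟩ <;> funext r <;>
        simp only [update_apply] <;> split_ifs <;> grind
  · intro τ
    simp only [run_mul, run_singleton, Instr.Step]
    rintro ⟨μ, h, -⟩
    have := congrFun h a
    simp [hab] at this
  · intro k hk
    simp [hab]
    omega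

theorem exists_clear (a : ℕ) : ∃ L, IsProgram L ∧ ∀ σ τ : ℕ → ℕ,
    Run L σ τ ↔ τ = update σ a 0 := by
  refine ⟨({[.dec a]})∗ * {[.zero a]}, (singleton _).kstar.mul (singleton _), fun σ τ => ?_⟩
  have := run_loop (B := {[.dec a]}) (a := a) (N := σ a) (τ := τ)
    (st := fun k => update σ a (σ a - k)) ?_ ?_ ?_
  · simpa using this
  · intro k hk τ
    simp only [run_singleton, Instr.Step]
    constructor
    · intro h
      funext r
      have h₁ := congrFun h r
      have h₂ := congrFun h a
      simp only [update_apply] at *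
      split_ifs at * <;> grind
    · rintro rfl
      funext r
      simp only [update_apply]
      split_ifs <;> grind
  · intro τ h
    have := congrFun (run_singleton.1 h) a
    simp at this
  · intro k hk
    simp
    omega

/-- Addition of `a` to `b` with the help of the empty register `t`. -/
theorem exists_copy {a b t : ℕ} (hab : a ≠ b) (hat : a ≠ t) (hbt : b ≠ t) :
    ∃ L, IsProgram L ∧ ∀ σ τ : ℕ → ℕ, σ t = 0 →
      (Run L σ τ ↔ τ = update σ b (σ b + σ a)) := by
  -- The loop moves `a` to `b` and `t` simultaneously; `M` then restores `a` from `t`.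
  obtain ⟨M, hM, hM'⟩ := exists_move hat.symm
  refine ⟨(({[.dec a]} * ({[.inc b]} * {[.inc t]}))∗ * {[.zero a]}) * M,
    (((singleton _).mul ((singleton _).mul (singleton _))).kstar.mul (singleton _)).mul hM,
    fun σ τ ht => ?_⟩
  have := fun τ => run_loop (B := {[.dec a]} * ({[.inc b]} * {[.inc t]})) (a := a) (N := σ a)
    (τ := τ) (st := fun k => update (update (update σ a (σ a - k)) b (σ b + k)) t k) ?_ ?_ ?_
  · simp only [Nat.sub_zero, update_eq_self, Nat.add_zero] at this
    rw [show update σ t 0 = σ by rw [← ht, update_eq_self]] at this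
    simp only [run_mul (L := _ * _) (M := M), this, exists_eq_left, hM']
    refine Eq.congr rfl ?_
    funext r
    simp only [update_apply]
    split_ifs <;> grind
  · intro k hk τ
    simp only [run_mul, run_singleton, Instr.Step]
    constructor
    · rintro ⟨μ, h, _, rfl, rfl⟩
      funext r
      have h₁ := congrFun h r
      have h₂ := congrFun h a
      have h₃ := congrFun h b
      have h₄ := congrFun h t
      simp only [update_apply] at *
      split_ifs at * <;> grind
    · rintro rfl
      refine ⟨update (update (update σ a (σ a - (k + 1))) b (σ b + k)) t k, ?_,
        update (update (update σ a (σ a - (k + 1))) b (σ b + (k + 1))) t k, ?_, ?_⟩ <;> funext r <;>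
        simp only [update_apply] <;> split_ifs <;> grind
  · intro τ
    simp only [run_mul, run_singleton, Instr.Step]
    rintro ⟨μ, h, -⟩
    have := congrFun h a
    simp [hab, hat] at this
  · intro k hk
    simp [hab, hat]
    omega

theorem exists_clear_range (s n : ℕ) : ∃ L, IsProgram L ∧ ∀ σ τ : ℕ → ℕ,
    Run L σ τ ↔ τ = fun r => if s ≤ r ∧ r < s + n then 0 else σ r := by
  induction n with
  | zero =>
    refine ⟨1, .one, fun σ τ => ?_⟩
    rw [run_one]
    refine Eq.congr rfl (funext fun r => ?_)
    rw [if_neg (by omega)]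
  | succ n ih =>
    obtain ⟨L, hL, h⟩ := ih
    obtain ⟨M, hM, h'⟩ := exists_clear (s + n)
    refine ⟨L * M, hL.mul hM, fun σ τ => ?_⟩
    simp only [run_mul, h, h', exists_eq_left]
    refine Eq.congr rfl (funext fun r => ?_)
    simp only [update_apply]
    split_ifs <;> first | rfl | omega

/-- The values of finitely many functions are computed one after the other. -/
theorem exists_computes_range {n m : ℕ} (g : Fin n → List.Vector ℕ m → ℕ) (ins : Fin m → ℕ) (s : ℕ)
    (hs : ∀ i, ins i < s) (hg : ∀ i : Fin n, ∃ L, IsProgram L ∧ Computes L (g i) ins (s + i) (s + n))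
    (k : ℕ) (hk : k ≤ n) : ∃ L, IsProgram L ∧ ∀ σ : ℕ → ℕ, (∀ r, s ≤ r → σ r = 0) → ∀ τ,
      Run L σ τ ↔ τ = fun r => if h : s ≤ r ∧ r < s + k then
        g ⟨r - s, by omega⟩ (.ofFn fun i => σ (ins i)) else σ r := by
  induction k with
  | zero =>
    refine ⟨1, .one, fun σ hσ τ => ?_⟩
    rw [run_one]
    refine Eq.congr rfl (funext fun r => ?_)
    rw [dif_neg (by omega)]
  | succ k ih =>
    obtain ⟨L, hL, h⟩ := ih (by omega)
    obtain ⟨M, hM, h'⟩ := hg ⟨k, hk⟩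
    refine ⟨L * M, hL.mul hM, fun σ hσ τ => ?_⟩
    simp only [run_mul, h σ hσ, exists_eq_left]
    rw [h']
    · refine Eq.congr rfl (funext fun r => ?_)
      -- The inputs lie below `s`, so the values computed earlier have not overwritten them.
      have : ∀ i, ¬ (s ≤ ins i ∧ ins i < s + k) := fun i => by have := hs i; omega
      simp only [update_apply, this, dite_false]
      by_cases hr : r = s + k
      · subst hr
        rw [if_pos rfl, dif_neg (by omega), dif_pos (by omega), hσ _ (by omega), Nat.zero_add]
        simp
      · rw [if_neg hr]
        split_ifs <;> first | rfl | omega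
    · intro r hr
      rw [dif_neg (by omega)]
      exact hσ r (by omega)

end IsProgram

section Run

variable {R : Type*} [DecidableEq R]

theorem run_mul_of {L M : Language (Instr R)} {σ ρ τ : R → ℕ} (h : ∀ μ, Run L σ μ ↔ μ = ρ) :
    Run (L * M) σ τ ↔ Run M ρ τ := by
  simp only [run_mul, h, exists_eq_left]

theorem Instr.step_dec_iff {r : R} {σ τ : R → ℕ} :
    (Instr.dec r).Step σ τ ↔ σ r ≠ 0 ∧ τ = Function.update σ r (σ r - 1) := by
  constructor
  · rintro rfl
    simp
  · rintro ⟨h, rfl⟩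
    simp [Step, Nat.sub_add_cancel (Nat.pos_of_ne_zero h)]

end Run

namespace IsProgram

open Function

/-- Induction on the construction of `f`, with `s` as the first register of the workspace. Since
inputs must survive and the workspace must be empty again at the end, values are copied rather than
moved out of the inputs, and auxiliary registers are cleared. A composition stores the inner values
in the registers from `s` to `s + n - 1` and works from `s + n` on. -/
theorem exists_computes {n : ℕ} {f : List.Vector ℕ n → ℕ} (hf : Nat.Primrec' f) (ins : Fin n → ℕ)
    (out s : ℕ) (hinj : Injective ins) (hins : ∀ i, ins i < s) (hout : out < s)
    (hne : ∀ i, ins i ≠ out) : ∃ L, IsProgram L ∧ Computes L f ins out s := by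
  induction hf generalizing out s with
  | zero =>
    refine ⟨1, .one, fun σ _ τ => ?_⟩
    rw [run_one, Nat.add_zero, update_eq_self]
  | succ =>
    obtain ⟨L, hL, h⟩ := exists_copy (hne 0) (hins 0).ne hout.ne
    refine ⟨L * {[.inc out]}, hL.mul (singleton _), fun σ hσ τ => ?_⟩
    rw [run_mul_of (fun μ => h σ μ (hσ s le_rfl)), run_singleton]
    simp [Instr.Step, List.Vector.head_ofFn, add_assoc]
  | get i =>
    obtain ⟨L, hL, h⟩ := exists_copy (hne i) (hins i).ne hout.ne
    refine ⟨L, hL, fun σ hσ τ => ?_⟩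
    simp only [h σ τ (hσ s le_rfl), List.Vector.get_ofFn]
  | @comp m n f g hf hg ihf ihg =>
    obtain ⟨L, hL, h⟩ := exists_computes_range g ins s hins (fun i =>
      ihg i ins (s + i) (s + n) hinj (fun j => (hins j).trans_le (by omega)) (by omega)
        (fun j => ((hins j).trans_le (by omega)).ne)) n le_rfl
    obtain ⟨M, hM, h'⟩ := ihf (fun i => s + i) out (s + n)
      (fun i j hij => by simpa [Fin.ext_iff] using hij) (fun i => by simp) (by omega)
      (fun i => by omega)
    obtain ⟨C, hC, h''⟩ := exists_clear_range s n
    refine ⟨L * (M * C), hL.mul (hM.mul hC), fun σ hσ τ => ?_⟩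
    rw [run_mul_of (h σ hσ), run_mul_of (h' _ ?_), h'']
    · refine Eq.congr rfl (funext fun r => ?_)
      have : ¬ (s ≤ out ∧ out < s + n) := by omega
      simp only [update_apply, this, dite_false, le_add_iff_nonneg_right, zero_le, true_and,
        Nat.add_lt_add_iff_left, Fin.is_lt, dite_true, Nat.add_sub_cancel_left, Fin.eta]
      split_ifs <;> first | rfl | omega | (rw [hσ r (by omega)])
    · intro r hr
      rw [dif_neg (by omega)]
      exact hσ r (by omega)
  | @prec n f g hf hg ihf ihg =>
    -- Register `s` counts the rounds, `s + 1` holds the current value of the recursion, `s + 2`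
    -- receives the next value, and the workspace starts at `s + 3`. The loop counts `ins 0` down;
    -- afterwards `ins 0` is restored from `s`, and `s + 1` is moved to `out`.
    have hne' : ∀ i : Fin n, ins i.succ ≠ ins 0 := fun i h => Fin.succ_ne_zero i (hinj h)
    have hinj' : Injective fun i : Fin n => ins i.succ :=
      fun i j h => Fin.succ_injective _ (hinj h)
    have hlt : ∀ i : Fin n, ins i.succ < s := fun i => hins _
    have ha := hins 0
    have hao := hne 0
    obtain ⟨Lf, hLf, hf'⟩ := ihf (fun i => ins i.succ) (s + 1) (s + 3) hinj'
      (fun i => (hlt i).trans_le (by omega)) (by omega) (fun i => ((hlt i).trans_le (by omega)).ne)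
    obtain ⟨Lg, hLg, hg'⟩ := ihg (Fin.cons s (Fin.cons (s + 1) fun i => ins i.succ)) (s + 2) (s + 3)
      (by
        rw [Fin.cons_injective_iff, Fin.cons_injective_iff]
        refine ⟨?_, ?_, hinj'⟩
        · rintro ⟨i, hi⟩
          refine Fin.cases ?_ (fun j => ?_) i hi
          · simp
          · simpa using (hlt j).ne
        · rintro ⟨i, hi⟩
          exact ((hlt i).trans_le (Nat.le_succ s)).ne hi)
      (Fin.cases (by simp) (Fin.cases (by simp) fun i => by
        simpa using (hlt i).trans_le (by omega)))
      (by omega)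
      (Fin.cases (by simp) (Fin.cases (by simp) fun i => by
        simpa using ((hlt i).trans_le (by omega)).ne))
    obtain ⟨Lc, hLc, hc⟩ := exists_clear (s + 1)
    obtain ⟨Lm, hLm, hm⟩ := exists_move (a := s + 2) (b := s + 1) (by omega)
    obtain ⟨L₁, hL₁, h₁⟩ := exists_move (a := s) (b := ins 0) ha.ne'
    obtain ⟨L₂, hL₂, h₂⟩ := exists_move (a := s + 1) (b := out) (by omega)
    refine ⟨Lf * (((({[.dec (ins 0)]} * (Lg * (Lc * (Lm * {[.inc s]}))))∗ * {[.zero (ins 0)]}) *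
      (L₁ * L₂))), hLf.mul ((((singleton _).mul (hLg.mul (hLc.mul (hLm.mul
        (singleton _))))).kstar.mul (singleton _)).mul (hL₁.mul hL₂)), fun σ hσ τ => ?_⟩
    set v : List.Vector ℕ n := .ofFn fun i => σ (ins i.succ) with hv
    set V : ℕ → ℕ := fun k => k.rec (f v) fun y IH => g (y ::ᵥ IH ::ᵥ v) with hV
    have hz₀ := hσ s le_rfl
    have hz₁ := hσ (s + 1) (by omega)
    have hz₂ := hσ (s + 2) (by omega)
    set st : ℕ → ℕ → ℕ := fun k => update (update (update σ (ins 0) (σ (ins 0) - k)) s k) (s + 1) (V k)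
      with hst
    have hstart : ∀ μ, Run Lf σ μ ↔ μ = st 0 := fun μ => by
      rw [hf' σ (fun r hr => hσ r (by omega))]
      refine Eq.congr rfl (funext fun r => ?_)
      simp only [hst, update_apply, hV, ← hv]
      split_ifs <;> simp_all
    have hloop : ∀ μ, Run (({[.dec (ins 0)]} * (Lg * (Lc * (Lm * {[.inc s]}))))∗ *
        {[.zero (ins 0)]}) (st 0) μ ↔ μ = st (σ (ins 0)) := by
      intro μ
      refine run_loop ?_ ?_ ?_
      · intro k hk τ
        have hdec : ∀ μ, Run {[.dec (ins 0)]} (st k) μ ↔ μ = update (st k) (ins 0)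
            (σ (ins 0) - (k + 1)) := fun μ => by
          have : st k (ins 0) = σ (ins 0) - k := by
            simp [hst, show ins 0 ≠ s + 1 by omega, ha.ne]
          rw [run_singleton, Instr.step_dec_iff, this, Nat.sub_sub]
          exact and_iff_right (by omega)
        rw [run_mul_of hdec, run_mul_of (hg' _ ?_), run_mul_of (hc _), run_mul_of (hm _),
          run_singleton]
        · have hvec : (List.Vector.ofFn fun i => update (st k) (ins 0) (σ (ins 0) - (k + 1))
              ((Fin.cons s (Fin.cons (s + 1) fun i => ins i.succ) : Fin (n + 2) → ℕ) i)) =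
              k ::ᵥ V k ::ᵥ v := by
            have e : ∀ i : Fin n, update (st k) (ins 0) (σ (ins 0) - (k + 1)) (ins i.succ) =
                σ (ins i.succ) := fun i => by
              have := hlt i
              have := hne' i
              simp only [hst, update_apply]
              split_ifs <;> first | rfl | omega
            have e₀ : update (st k) (ins 0) (σ (ins 0) - (k + 1)) s = k := by
              simp [hst, ha.ne']
            have e₁ : update (st k) (ins 0) (σ (ins 0) - (k + 1)) (s + 1) = V k := by
              simp [hst, show s + 1 ≠ ins 0 by omega]
            simp only [List.Vector.ofFn, Fin.cons_zero, Fin.cons_succ, e, e₀, e₁, hv]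
          rw [hvec, Instr.Step]
          refine Eq.congr rfl (funext fun r => ?_)
          simp only [hst, update_apply, show V (k + 1) = g (k ::ᵥ V k ::ᵥ v) from rfl]
          split_ifs <;> first | rfl | omega | simp_all
        · intro r hr
          simp only [hst, update_apply]
          rw [if_neg (by omega), if_neg (by omega), if_neg (by omega), if_neg (by omega)]
          exact hσ r (by omega)
      · intro τ
        rw [run_mul]
        rintro ⟨μ, h, -⟩
        rw [run_singleton, Instr.step_dec_iff] at h
        refine h.1 ?_
        simp [hst, show ins 0 ≠ s + 1 by omega, ha.ne]
      · intro k hk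
        simp [hst, show ins 0 ≠ s + 1 by omega, ha.ne]
        omega
    rw [run_mul_of hstart, run_mul_of hloop, run_mul_of (h₁ _), h₂]
    refine Eq.congr rfl (funext fun r => ?_)
    have : (List.Vector.ofFn fun i => σ (ins i)).tail = v := by simp [hv]
    beta_reduce
    rw [this, List.Vector.head_ofFn, show ∀ x, x.rec (f v) (fun y IH => g (y ::ᵥ IH ::ᵥ v)) = V x from
      fun _ => rfl]
    clear_value V
    simp only [hst, update_apply]
    split_ifs <;> first | omega | exact (hσ r (by omega)).symm | (rw [‹r = ins 0›]; omega)

end IsProgram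

/-! ### Renaming of registers; registers outside the range of the renaming stay empty. -/

section Renaming

open Function

variable {R S : Type*} [DecidableEq R] [DecidableEq S] {f : R → S}

theorem Exec.of_map (hf : Injective f) {u : List (Instr R)} {σ τ : S → ℕ}
    (h : Exec (u.map (Instr.map f)) σ τ) : Exec u (σ ∘ f) (τ ∘ f) := by
  induction u generalizing σ with
  | nil => cases h; rfl
  | cons i u ih =>
    obtain ⟨μ, h₁, h₂⟩ := h
    refine ⟨μ ∘ f, ?_, ih h₂⟩
    cases i with
    | inc r =>
      cases h₁
      exact update_comp_eq_of_injective _ hf _ _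
    | dec r =>
      cases h₁
      exact update_comp_eq_of_injective _ hf _ _
    | zero r =>
      obtain ⟨h₀, rfl⟩ := h₁
      exact ⟨h₀, rfl⟩

theorem extend_update (hf : Injective f) (σ : R → ℕ) (r : R) (x : ℕ) :
    extend f (update σ r x) 0 = update (extend f σ 0) (f r) x := by
  funext s
  by_cases hs : ∃ r', f r' = s
  · obtain ⟨r', rfl⟩ := hs
    rw [hf.extend_apply, ← comp_apply (f := update (extend f σ 0) (f r) x) (g := f),
      update_comp_eq_of_injective _ hf, extend_comp hf]
  · rw [extend_apply' _ _ _ hs, update_of_ne (fun h => hs ⟨r, h.symm⟩), extend_apply' _ _ _ hs]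

theorem Exec.map (hf : Injective f) {u : List (Instr R)} {σ τ : R → ℕ} (h : Exec u σ τ) :
    Exec (u.map (Instr.map f)) (extend f σ 0) (extend f τ 0) := by
  induction u generalizing σ with
  | nil => cases h; rfl
  | cons i u ih =>
    obtain ⟨μ, h₁, h₂⟩ := h
    refine ⟨extend f μ 0, ?_, ih h₂⟩
    cases i with
    | inc r =>
      cases h₁
      simp only [Instr.map, Instr.Step, extend_update hf, hf.extend_apply]
    | dec r =>
      cases h₁
      simp only [Instr.map, Instr.Step, extend_update hf, hf.extend_apply]
    | zero r =>
      obtain ⟨h₀, rfl⟩ := h₁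
      exact ⟨by simpa only [hf.extend_apply], rfl⟩

end Renaming

/-! ### Undecidability of reachability for counter programs. -/

/-- A set of numbers whose membership problem has a primitive recursive matrix and is
undecidable. -/
theorem exists_primrec_undecidable : ∃ g : ℕ → ℕ → ℕ, Primrec₂ g ∧
    ¬ ∃ f : ℕ → Bool, Computable f ∧ ∀ n, f n = true ↔ ∃ k, g n k = 0 := by
  classical
  -- `g n k = 0` says that the code with number `n` halts on input `0` within the bound `k`.
  refine ⟨fun n k => cond (Nat.Partrec.Code.evaln k (Denumerable.ofNat Nat.Partrec.Code n) 0).isSome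
    0 1, ?_, ?_⟩
  · refine Primrec.cond (Primrec.option_isSome.comp ?_) (Primrec.const 0) (Primrec.const 1)
    exact Nat.Partrec.Code.primrec_evaln.comp (Primrec.pair (Primrec.pair Primrec.snd
      ((Primrec.ofNat Nat.Partrec.Code).comp Primrec.fst)) (Primrec.const 0))
  · rintro ⟨f, hf, h⟩
    refine ComputablePred.halting_problem 0 ?_
    refine ⟨Classical.decPred _, (hf.comp Computable.encode).of_eq fun c => ?_⟩
    rw [Bool.eq_iff_iff, h, decide_eq_true_iff]
    simp only [Part.dom_iff_mem, Nat.Partrec.Code.evaln_complete, Denumerable.ofNat_encode]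
    rw [exists_comm]
    refine exists_congr fun k => ?_
    cases h : Nat.Partrec.Code.evaln k c 0 <;> simp

-- The program guesses `k` in register 1, adds `g n k` to register 2, tests that register for zero
-- and empties registers 0 and 1. That `L` omits the empty word guarantees later that an encoded run
-- has a block besides the initial one.
open Function in
theorem exists_program_undecidable : ∃ L, IsProgram L ∧ [] ∉ L ∧
    ¬ ∃ f : ℕ → Bool, Computable f ∧ ∀ n, f n = true ↔ Run L (Pi.single 0 n) 0 := by
  obtain ⟨g, hg, hund⟩ := exists_primrec_undecidable
  obtain ⟨P, hP, h⟩ := IsProgram.exists_computes (Nat.Primrec'.prim_iff₂.2 hg) (fun i => i) 2 3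
    Fin.val_injective (fun i => by omega) (by omega) (fun i => by omega)
  obtain ⟨C₀, hC₀, h₀⟩ := IsProgram.exists_clear 0
  obtain ⟨C₁, hC₁, h₁⟩ := IsProgram.exists_clear 1
  have hinc : ∀ σ τ : ℕ → ℕ, Run ({[Instr.inc 1]}∗) σ τ ↔ ∃ k, τ = update σ 1 (σ 1 + k) := by
    intro σ τ
    rw [run_kstar]
    constructor
    · intro h
      induction h with
      | refl => exact ⟨0, by simp⟩
      | tail _ h ih =>
        obtain ⟨k, rfl⟩ := ih
        rw [run_singleton] at h
        exact ⟨k + 1, by simpa [Instr.Step, add_assoc] using h⟩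
    · rintro ⟨k, rfl⟩
      induction k with
      | zero => simpa using Relation.ReflTransGen.refl
      | succ k ih =>
        refine ih.tail (run_singleton.2 ?_)
        simp [Instr.Step, add_assoc]
  refine ⟨{[.inc 1]}∗ * (P * ({[.zero 2]} * (C₀ * C₁))), (IsProgram.singleton _).kstar.mul (hP.mul
    ((IsProgram.singleton _).mul (hC₀.mul hC₁))), ?_, ?_⟩
  · rintro ⟨_, _, _, ⟨_, _, _, ⟨_, rfl, _, _, rfl⟩, rfl⟩, h⟩
    simp at h
  · rintro ⟨f, hf, hf'⟩
    refine hund ⟨f, hf, fun n => (hf' n).trans ?_⟩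
    have key : ∀ k, Run (P * ({[.zero 2]} * (C₀ * C₁)))
        (update (Pi.single 0 n : ℕ → ℕ) 1 ((Pi.single 0 n : ℕ → ℕ) 1 + k)) 0 ↔ g n k = 0 := by
      intro k
      have e : (List.Vector.ofFn fun i : Fin 2 =>
          update (Pi.single 0 n : ℕ → ℕ) 1 ((Pi.single 0 n : ℕ → ℕ) 1 + k) i) =
          n ::ᵥ k ::ᵥ List.Vector.nil := by
        simp [List.Vector.ofFn]
      rw [run_mul_of (h _ fun r hr => by
        simp [show r ≠ 0 by omega, show r ≠ 1 by omega]), e, run_mul]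
      simp only [run_singleton, Instr.Step]
      constructor
      · rintro ⟨_, ⟨h, -⟩, -⟩
        simpa using h
      · intro h
        refine ⟨_, ⟨by simpa using h, rfl⟩, ?_⟩
        rw [run_mul_of (h₀ _), h₁]
        funext r
        simp only [update_apply, Pi.single_apply, Pi.zero_apply]
        split_ifs <;> simp_all
    rw [run_mul]
    simp only [hinc]
    constructor
    · rintro ⟨_, ⟨k, rfl⟩, h⟩
      exact ⟨k, (key k).1 h⟩
    · rintro ⟨k, h⟩
      exact ⟨_, ⟨k, rfl⟩, (key k).2 h⟩

/-- A regular language over the instructions with finitely many registers for which it is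
undecidable whether the empty configuration can be reached from a given input. -/
theorem exists_language_undecidable : ∃ (K : ℕ) (r₀ : Fin K) (L : Language (Instr (Fin K))),
    L.IsRegular ∧ [] ∉ L ∧
    ¬ ∃ f : ℕ → Bool, Computable f ∧ ∀ n, f n = true ↔ Run L (Pi.single r₀ n) 0 := by
  obtain ⟨L, ⟨⟨Q, _, M, hM⟩, K, hK⟩, hnil, hund⟩ := exists_program_undecidable
  -- `K + 1` registers are used so that the input register `0` exists even if `K = 0`.
  have hinj : Function.Injective (Fin.val : Fin (K + 1) → ℕ) := Fin.val_injective
  refine ⟨K + 1, 0, {u | u.map (Instr.map Fin.val) ∈ L},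
    ⟨Q, inferInstance, M.comap (Instr.map Fin.val), by rw [DFA.accepts_comap, hM]; rfl⟩, hnil, ?_⟩
  rintro ⟨f, hf, h⟩
  refine hund ⟨f, hf, fun n => (h n).trans ?_⟩
  constructor
  · rintro ⟨u, hu, h⟩
    refine ⟨_, hu, ?_⟩
    have := h.map hinj
    rwa [← Pi.single_zero (0 : Fin (K + 1)), Pi.single, Pi.single, extend_update hinj,
      extend_update hinj, show Function.extend Fin.val (0 : Fin (K + 1) → ℕ) 0 = 0 from
        Function.extend_zero _, show Function.update (0 : ℕ → ℕ) (0 : Fin (K + 1)).val 0 = 0 from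
        Function.update_eq_self _ _] at this
  · rintro ⟨u, hu, h⟩
    -- A word of `L` uses only registers below `K`, so it is the image of a word over the finite set
    -- of registers.
    have : u ∈ Set.range (List.map (Instr.map (Fin.val : Fin (K + 1) → ℕ))) := by
      rw [Set.range_list_map]
      intro i hi
      have := (hK u hu i hi).trans K.lt_succ_self
      cases i with
      | inc r => exact ⟨.inc ⟨r, this⟩, rfl⟩
      | dec r => exact ⟨.dec ⟨r, this⟩, rfl⟩
      | zero r => exact ⟨.zero ⟨r, this⟩, rfl⟩
    obtain ⟨u, rfl⟩ := this
    refine ⟨u, hu, ?_⟩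
    have := h.of_map hinj
    rwa [show (Pi.single 0 n : ℕ → ℕ) ∘ Fin.val = (Pi.single (0 : Fin (K + 1)) n : Fin (K + 1) → ℕ)
      from Function.update_comp_eq_of_injective (0 : ℕ → ℕ) hinj (0 : Fin (K + 1)) n] at this

/-! ### Definable properties of positions -/

section Definable

variable {A D : Type*} {m n : ℕ} {F : Fin m → Language A}

/-- `P w X x y` is expressed by a two-variable formula. -/
def Definable (F : Fin m → Language A) (P : List (A × D) → (Fin n → Set ℕ) → ℕ → ℕ → Prop) : Prop :=
  ∃ φ : FO2 A m n, ∀ w X s, φ.Holds F w X s ↔ P w X (s 0) (s 1)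

namespace Definable

variable {P Q : List (A × D) → (Fin n → Set ℕ) → ℕ → ℕ → Prop}

theorem not (h : Definable F P) : Definable F fun w X x y => ¬ P w X x y := by
  obtain ⟨φ, h⟩ := h
  exact ⟨.neg φ, fun w X s => not_congr (h w X s)⟩

theorem and (h : Definable F P) (h' : Definable F Q) :
    Definable F fun w X x y => P w X x y ∧ Q w X x y := by
  obtain ⟨φ, h⟩ := h
  obtain ⟨ψ, h'⟩ := h'
  exact ⟨.and φ ψ, fun w X s => and_congr (h w X s) (h' w X s)⟩

theorem congr (h : Definable F P) (hPQ : ∀ w X x y, P w X x y ↔ Q w X x y) : Definable F Q := by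
  obtain ⟨φ, h⟩ := h
  exact ⟨φ, fun w X s => (h w X s).trans (hPQ _ _ _ _)⟩

theorem or (h : Definable F P) (h' : Definable F Q) :
    Definable F fun w X x y => P w X x y ∨ Q w X x y :=
  (h.not.and h'.not).not.congr fun _ _ _ _ => by tauto

theorem imp (h : Definable F P) (h' : Definable F Q) :
    Definable F fun w X x y => P w X x y → Q w X x y :=
  (h.and h'.not).not.congr fun _ _ _ _ => by tauto

theorem exX (h : Definable F P) : Definable F fun w X _ y => ∃ x < w.length, P w X x y := by
  obtain ⟨φ, h⟩ := h
  exact ⟨.ex 0 φ, fun w X s => exists_congr fun p => and_congr_right fun _ => by simp [h]⟩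

theorem exY (h : Definable F P) : Definable F fun w X x _ => ∃ y < w.length, P w X x y := by
  obtain ⟨φ, h⟩ := h
  exact ⟨.ex 1 φ, fun w X s => exists_congr fun p => and_congr_right fun _ => by simp [h]⟩

theorem allX (h : Definable F P) : Definable F fun w X _ y => ∀ x < w.length, P w X x y :=
  h.not.exX.not.congr fun _ _ _ _ => by push Not; rfl

theorem allY (h : Definable F P) : Definable F fun w X x _ => ∀ y < w.length, P w X x y :=
  h.not.exY.not.congr fun _ _ _ _ => by push Not; rfl

/-- The case distinction need not be effective: the formula built from these pieces is fixed and
never computed from the input. -/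
theorem const (p : Prop) : Definable F fun (_ : List (A × D)) (_ : Fin n → Set ℕ) _ _ => p := by
  by_cases hp : p
  · exact ⟨.eq 0 0, fun w X s => by simp [FO2.Holds, hp]⟩
  · exact ⟨.neg (.eq 0 0), fun w X s => by simp [FO2.Holds, hp]⟩

theorem exists_finite {ι : Type*} [Finite ι]
    {P : ι → List (A × D) → (Fin n → Set ℕ) → ℕ → ℕ → Prop} (h : ∀ i, Definable F (P i)) :
    Definable F fun w X x y => ∃ i, P i w X x y := by
  cases nonempty_fintype ι
  suffices H : ∀ T : Finset ι, Definable F fun w X x y => ∃ i ∈ T, P i w X x y from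
    (H Finset.univ).congr fun _ _ _ _ => by simp
  classical
  intro T
  induction T using Finset.induction with
  | empty => exact (const False).congr fun _ _ _ _ => by simp
  | insert i T _ ih => exact ((h i).or ih).congr fun _ _ _ _ => by simp

theorem forall_finite {ι : Type*} [Finite ι]
    {P : ι → List (A × D) → (Fin n → Set ℕ) → ℕ → ℕ → Prop} (h : ∀ i, Definable F (P i)) :
    Definable F fun w X x y => ∀ i, P i w X x y :=
  (exists_finite fun i => (h i).not).not.congr fun _ _ _ _ => by push Not; rfl

theorem letterX (a : A) : Definable F fun (w : List (A × D)) (_ : Fin n → Set ℕ) x _ =>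
    HasLabel w a x :=
  ⟨.letter a 0, fun _ _ _ => Iff.rfl⟩

theorem memX (i : Fin n) : Definable F fun (_ : List (A × D)) (X : Fin n → Set ℕ) x _ => x ∈ X i :=
  ⟨.inSet i 0, fun _ _ _ => Iff.rfl⟩

theorem memY (i : Fin n) : Definable F fun (_ : List (A × D)) (X : Fin n → Set ℕ) _ y => y ∈ X i :=
  ⟨.inSet i 1, fun _ _ _ => Iff.rfl⟩

theorem lt : Definable F fun (_ : List (A × D)) (_ : Fin n → Set ℕ) x y => x < y :=
  ⟨.lt 0 1, fun _ _ _ => Iff.rfl⟩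

theorem gt : Definable F fun (_ : List (A × D)) (_ : Fin n → Set ℕ) x y => y < x :=
  ⟨.lt 1 0, fun _ _ _ => Iff.rfl⟩

theorem succ : Definable F fun (_ : List (A × D)) (_ : Fin n → Set ℕ) x y => y = x + 1 :=
  ⟨.succ 0 1, fun _ _ _ => Iff.rfl⟩

theorem classSucc : Definable F fun (w : List (A × D)) (_ : Fin n → Set ℕ) x y => ClassSucc w x y :=
  ⟨.classSucc 0 1, fun _ _ _ => Iff.rfl⟩

theorem guarded (i : Fin m) : Definable F fun (w : List (A × D)) (_ : Fin n → Set ℕ) x y =>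
    GuardedPred w (F i) x y :=
  ⟨.guarded i 0 1, fun _ _ _ => Iff.rfl⟩

end Definable

end Definable

/-! ### Numbers as positions -/

section Reduction

variable {A : Type*} {D : Type*} {m N : ℕ}

/-- The formula that says that exactly `k` positions precede `x`. -/
def atPosition (A : Type*) (m N : ℕ) : ℕ → FO2 A m N
  | 0 => .neg (.ex 1 (.lt 1 0))
  | k + 1 => .ex 1 (.and (.succ 1 0) (.ex 0 (.and (.eq 0 1) (atPosition A m N k))))

/-- Rebinding `x` to the predecessor held by `y` frees `y` again, so two variables suffice for every
`k`. -/
theorem holds_atPosition (F : Fin m → Language A) (w : List (A × D)) (X : Fin N → Set ℕ) (k : ℕ)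
    (s : Var → ℕ) (hs : s 0 < w.length) : (atPosition A m N k).Holds F w X s ↔ s 0 = k := by
  induction k generalizing s with
  | zero =>
    simp only [atPosition, FO2.Holds, Function.update_self,
      Function.update_of_ne (show (0 : Var) ≠ 1 by decide)]
    constructor
    · intro h
      by_contra h0
      exact h ⟨0, by omega, by omega⟩
    · rintro h ⟨p, _, hp⟩
      omega
  | succ k ih =>
    simp only [atPosition, FO2.Holds, Function.update_self,
      Function.update_of_ne (show (0 : Var) ≠ 1 by decide),
      Function.update_of_ne (show (1 : Var) ≠ 0 by decide)]
    constructor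
    · rintro ⟨p, _, hp, q, hq, rfl, h⟩
      rw [ih _ (by simpa using hq), Function.update_self] at h
      omega
    · intro h
      refine ⟨k, by omega, h, k, by omega, rfl, ?_⟩
      rw [ih _ (by simp; omega), Function.update_self]

/-- The sentence that says that the position with number `k` satisfies `θ`. -/
def sentenceAt (θ : FO2 A m N) (k : ℕ) : EMSO2 A m where
  n := N
  matrix := .ex 1 (.ex 0 (.and θ (atPosition A m N k)))
  closed := by
    ext u
    fin_cases u <;> simp [FO2.free]

/-- Only the part `atPosition` depends on `k`, and its code arises by iterating one primitive
recursive map `k` times. -/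
theorem computable_code_sentenceAt [Encodable A] (θ : FO2 A m N) :
    Computable fun k => (sentenceAt θ k).code := by
  have pair : ∀ (c : ℕ) {f : ℕ → ℕ}, Primrec f → Primrec fun k => Nat.pair c (f k) :=
    fun c f hf => Primrec₂.natPair.comp (Primrec.const c) hf
  have hpos : Primrec fun k => (atPosition A m N k).code := by
    have step := pair 10 (pair (1 : Var).val (pair 9 (pair (FO2.code (.succ 1 0 : FO2 A m N))
      (pair 10 (pair (0 : Var).val (pair 9 (pair (FO2.code (.eq 0 1 : FO2 A m N)) Primrec.id)))))))
    refine (Primrec.nat_iterate Primrec.id (Primrec.const (atPosition A m N 0).code)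
      (step.comp Primrec.snd).to₂).of_eq fun k => ?_
    induction k with
    | zero => simp only [id, Function.iterate_zero]
    | succ k ih =>
      simp only [id] at ih
      simp only [id, Function.iterate_succ_apply', ih]
      simp only [atPosition, FO2.code]
  refine (pair N (pair 10 (pair (1 : Var).val (pair 10 (pair (0 : Var).val (pair 9
    (pair θ.code hpos))))))).to_comp.of_eq fun k => ?_
  simp only [EMSO2.code, sentenceAt, FO2.code]

/-- The position `q` assigned to `y` is a dummy; its quantifier only serves to close the sentence.
-/
theorem models_sentenceAt {F : Fin m → Language A} {w : List (A × D)} {θ : FO2 A m N} {k : ℕ} :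
    (sentenceAt θ k).Models F w ↔ ∃ X : Fin N → Set ℕ, (∀ i, ∀ p ∈ X i, p < w.length) ∧
      ∃ q < w.length, ∃ p < w.length,
        θ.Holds F w X (Function.update (Function.update (fun _ => 0) 1 q) 0 p) ∧
        (atPosition A m N k).Holds F w X (Function.update (Function.update (fun _ => 0) 1 q) 0 p) :=
  Iff.rfl

/-- An undecidable problem that is expressed by a definable property of the position `n + 2` is
reduced to satisfiability. -/
theorem not_isDecidable_satisfiable [Encodable A] {F : Fin m → Language A} {P : ℕ → Prop}
    (hP : ¬ ∃ f : ℕ → Bool, Computable f ∧ ∀ n, f n = true ↔ P n)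
    {Θ : List (A × D) → (Fin N → Set ℕ) → ℕ → Prop} (hΘ : Definable F fun w X x _ => Θ w X x)
    (h : ∀ n, P n ↔ ∃ (w : List (A × D)) (X : Fin N → Set ℕ), (∀ i, ∀ p ∈ X i, p < w.length) ∧
      n + 2 < w.length ∧ Θ w X (n + 2)) :
    ¬ EMSO2.IsDecidable fun ψ : EMSO2 A m => ψ.Satisfiable D F := by
  rintro ⟨f, hf, hdec⟩
  obtain ⟨θ, hθ⟩ := hΘ
  refine hP ⟨fun n => f (sentenceAt θ (n + 2)).code, hf.comp ((computable_code_sentenceAt θ).comp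
    (Primrec.nat_add.comp Primrec.id (Primrec.const 2)).to_comp), fun n => ?_⟩
  rw [hdec, h]
  refine exists_congr fun w => models_sentenceAt.trans ?_
  refine exists_congr fun X => and_congr_right fun _ => ?_
  constructor
  · rintro ⟨q, _, p, hp, h₁, h₂⟩
    rw [holds_atPosition _ _ _ _ _ (by simpa using hp), Function.update_self] at h₂
    subst h₂
    rw [hθ] at h₁
    exact ⟨hp, by simpa using h₁⟩
  · rintro ⟨hp, hΘ⟩
    refine ⟨0, by omega, n + 2, hp, ?_, ?_⟩
    · rw [hθ]
      simpa using hΘ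
    · rw [holds_atPosition _ _ _ _ _ (by simpa using hp), Function.update_self]

end Reduction

/-! ### Runs of counter programs as data words

A run is encoded by a sequence of blocks. A block starts with a separator and a slot, which are
followed by one element for each unit stored in a register. The block is labelled by the current
instruction. An element of a block and its copy in the next block carry the same data value. The
slot is the new unit if the instruction is an increment, the vanishing unit if it is a decrement. -/

/-- The role of a position in a block. -/
inductive Kind (R : Type*)
  | sep
  | slot
  | elem (r : R)

/-- The labels of positions: the parity of the number of the block, the current state and
instruction, and the role of the position. -/
structure Label (Q R : Type*) where
  /-- parity of the number of the block -/
  par : Bool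
  /-- state and instruction, absent in the initial block -/
  op : Option (Q × Instr R)
  /-- role of the position -/
  kind : Kind R

section Label

variable {Q R : Type*}

instance [Finite R] : Finite (Kind R) := by
  refine Finite.of_injective (β := Option (Option R)) (fun
    | .sep => none
    | .slot => some none
    | .elem r => some (some r)) ?_
  rintro (_ | _ | r) (_ | _ | s) h <;> simp_all

instance [Finite Q] [Finite R] : Finite (Label Q R) := by
  refine Finite.of_injective (β := Bool × Option (Q × Instr R) × Kind R)
    (fun l => (l.par, l.op, l.kind)) ?_
  rintro ⟨⟩ ⟨⟩ h
  simpa using h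

namespace Label

/-- Whether a position is a separator. -/
def isSep (l : Label Q R) : Bool :=
  match l.kind with
  | .sep => true
  | _ => false

theorem isSep_iff {l : Label Q R} : l.isSep = true ↔ l.kind = .sep := by
  unfold isSep
  cases l.kind <;> simp

/-- The register of a unit that comes from the previous block. -/
def inMark (l : Label Q R) : Option R :=
  match l.op, l.kind with
  | some _, .elem r => some r
  | some (_, .dec r), .slot => some r
  | _, _ => none

/-- The register of a unit that is passed on to the next block. -/
def outMark (l : Label Q R) : Option R :=
  match l.op, l.kind with
  | _, .elem r => some r
  | some (_, .inc r), .slot => some r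
  | _, _ => none

theorem inMark_eq_some_iff {l : Label Q R} {r : R} : l.inMark = some r ↔
    (l.op ≠ none ∧ l.kind = .elem r) ∨ ∃ q, l.op = some (q, .dec r) ∧ l.kind = .slot := by
  obtain ⟨_, (_ | ⟨_, _ | _ | _⟩), (_ | _ | _)⟩ := l <;> simp [inMark]

theorem outMark_eq_some_iff {l : Label Q R} {r : R} : l.outMark = some r ↔
    l.kind = .elem r ∨ ∃ q, l.op = some (q, .inc r) ∧ l.kind = .slot := by
  obtain ⟨_, (_ | ⟨_, _ | _ | _⟩), (_ | _ | _)⟩ := l <;> simp [outMark]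

theorem isSep_of_inMark {l : Label Q R} {r : R} (h : l.inMark = some r) : l.isSep = false := by
  unfold isSep
  rcases inMark_eq_some_iff.1 h with ⟨_, h⟩ | ⟨_, _, h⟩ <;> rw [h]

/-- The state after a block. -/
def nextState (M : DFA (Instr R) Q) : Option (Q × Instr R) → Q
  | none => M.start
  | some (q, i) => M.step q i

/-- The condition on the labels of successive positions. -/
structure Adj (M : DFA (Instr R) Q) (r₀ : R) (l l' : Label Q R) : Prop where
  slot_iff : l'.kind = .slot ↔ l.kind = .sep
  same : l'.isSep = false → l'.par = l.par ∧ l'.op = l.op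
  sep : l'.isSep = true → l'.par = !l.par ∧ ∃ i, l'.op = some (nextState M l.op, i)
  elem : ∀ r, l'.kind = .elem r → (l'.op = none → r = r₀) ∧ ∀ q, l'.op ≠ some (q, .zero r)

end Label

/-- Exactly one separator lies strictly between `p` and `q`. -/
def OneSep (sep : ℕ → Bool) (p q : ℕ) : Prop :=
  p < q ∧ ∃! k, p < k ∧ k < q ∧ sep k = true

variable {A D : Type*}

/-- The labels `lab` turn `w` into the encoding of a run of `M` on the input `n`. -/
structure Valid (M : DFA (Instr R) Q) (r₀ : R) (n : ℕ) (w : List (A × D)) (lab : ℕ → Label Q R) :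
    Prop where
  first : lab 0 = ⟨true, none, .sep⟩
  last : ∀ p, p + 1 = w.length → (lab p).kind ≠ .sep ∧
    ∃ q i, (lab p).op = some (q, i) ∧ M.step q i ∈ M.accept
  adj : ∀ p, p + 1 < w.length → (lab p).Adj M r₀ (lab (p + 1))
  class_succ : ∀ p q, ClassSucc w p q → OneSep (fun k => (lab k).isSep) p q
  out : ∀ p < w.length, ∀ r, (lab p).outMark = some r → ∃ q < w.length, (SameClass w p q ∧
    OneSep (fun k => (lab k).isSep) p q) ∧ (lab q).inMark = some r
  in' : ∀ q < w.length, ∀ r, (lab q).inMark = some r → ∃ p < w.length, (SameClass w p q ∧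
    OneSep (fun k => (lab k).isSep) p q) ∧ (lab p).outMark = some r
  -- The initial block consists of a separator, a slot and `n` elements, so `n + 2` is where the
  -- next block starts.
  lt : n + 2 < w.length
  init : (lab (n + 2)).op ≠ none
  before : ∀ p < n + 2, (lab p).op = none

end Label

section SameClass

variable {A D : Type*} {w : List (A × D)} {p q r : ℕ}

theorem SameClass.symm (h : SameClass w p q) : SameClass w q p := by
  obtain ⟨d, h₁, h₂⟩ := h
  exact ⟨d, h₂, h₁⟩

theorem SameClass.trans (h : SameClass w p q) (h' : SameClass w q r) : SameClass w p r := by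
  obtain ⟨d, h₁, h₂⟩ := h
  obtain ⟨e, h₃, h₄⟩ := h'
  rw [h₂] at h₃
  exact ⟨d, h₁, h₃ ▸ h₄⟩

theorem SameClass.lt_length (h : SameClass w p q) : p < w.length := by
  obtain ⟨d, h₁, h₂⟩ := h
  by_contra hp
  simp [List.getElem?_eq_none (not_lt.1 hp)] at h₁

theorem SameClass.exists_classSucc (h : SameClass w p q) (hpq : p < q) :
    ∃ r ≤ q, ClassSucc w p r := by
  classical
  have hex : ∃ r, p < r ∧ SameClass w p r := ⟨q, hpq, h⟩
  refine ⟨Nat.find hex, Nat.find_min' hex ⟨hpq, h⟩, (Nat.find_spec hex).2, (Nat.find_spec hex).1, ?_⟩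
  intro k hk hk' hpk
  exact Nat.find_min hex hk' ⟨hk, hpk⟩

end SameClass

/-! ### Numbers of blocks -/

section Block

variable {sep : ℕ → Bool} {p q k : ℕ}

/-- The number of separators up to `p`. -/
def blk (sep : ℕ → Bool) (p : ℕ) : ℕ := Nat.count (fun k => sep k = true) (p + 1)

theorem blk_succ (sep : ℕ → Bool) (p : ℕ) :
    blk sep (p + 1) = blk sep p + if sep (p + 1) = true then 1 else 0 :=
  Nat.count_succ _ _

theorem blk_mono (h : p ≤ q) : blk sep p ≤ blk sep q :=
  Nat.count_monotone _ (by omega)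

theorem blk_lt (hpk : p < k) (hkq : k ≤ q) (hk : sep k = true) : blk sep p < blk sep q := by
  obtain ⟨k, rfl⟩ : ∃ j, k = j + 1 := ⟨k - 1, by omega⟩
  have := blk_succ sep k
  rw [if_pos hk] at this
  have h₁ := blk_mono (sep := sep) hkq
  have h₂ := blk_mono (sep := sep) (show p ≤ k by omega)
  omega

theorem blk_eq (hpq : p ≤ q) (h : ∀ k, p < k → k ≤ q → sep k = false) :
    blk sep q = blk sep p := by
  induction q, hpq using Nat.le_induction with
  | base => rfl
  | succ q hq ih =>
    rw [blk_succ, ih fun k h₁ h₂ => h k h₁ (by omega), h (q + 1) (by omega) le_rfl]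
    simp

theorem blk_eq_succ (hpk : p < k) (hkq : k ≤ q) (hk : sep k = true)
    (h : ∀ j, p < j → j ≤ q → sep j = true → j = k) : blk sep q = blk sep p + 1 := by
  obtain ⟨k, rfl⟩ : ∃ j, k = j + 1 := ⟨k - 1, by omega⟩
  rw [blk_eq hkq, blk_succ, if_pos hk, blk_eq (q := k) (p := p) (by omega)]
  · intro j h₁ h₂
    by_contra hj
    have := h j h₁ (by omega) (by simpa using hj)
    omega
  · intro j h₁ h₂
    by_contra hj
    have := h j (by omega) h₂ (by simpa using hj)
    omega

/-- A separator at `q` itself would be counted by `blk` but not by `OneSep`, hence the condition on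
`q`. -/
theorem OneSep.blk_eq (h : OneSep sep p q) (hq : sep q = false) : blk sep q = blk sep p + 1 := by
  obtain ⟨_, k, ⟨h₁, h₂, h₃⟩, h₄⟩ := h
  refine blk_eq_succ h₁ h₂.le h₃ fun j hj hj' hs => h₄ j ⟨hj, lt_of_le_of_ne hj' ?_, hs⟩
  rintro rfl
  simp [hq] at hs

end Block

/-! ### From data words to runs -/

namespace Valid

open Finset

variable {Q R A D : Type*} {M : DFA (Instr R) Q} {r₀ : R} {n : ℕ} {w : List (A × D)}
  {lab : ℕ → Label Q R}

/-- The number of the block of a position. -/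
local notation "β" => blk (fun k => Label.isSep (lab k))

/-- A class meets each block at most once, because a separator lies between a position and its class
successor. -/
theorem eq_of_sameClass (V : Valid M r₀ n w lab) {p q : ℕ} (h : SameClass w p q)
    (hb : β p = β q) : p = q := by
  wlog hpq : p < q generalizing p q
  · rcases (not_lt.1 hpq).eq_or_lt with h' | h'
    · exact h'.symm
    · exact (this h.symm hb.symm h').symm
  obtain ⟨r, hr, hs⟩ := h.exists_classSucc hpq
  obtain ⟨_, k, ⟨h₁, h₂, h₃⟩, _⟩ := V.class_succ p r hs
  have := blk_lt (sep := fun k => (lab k).isSep) h₁ (h₂.le.trans hr) h₃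
  omega

theorem op_eq (V : Valid M r₀ n w lab) {p q : ℕ} (hpq : p ≤ q) (hq : q < w.length)
    (hb : β q = β p) : (lab q).op = (lab p).op := by
  induction q, hpq using Nat.le_induction with
  | base => rfl
  | succ q hq' ih =>
    have h₁ := blk_mono (sep := fun k => (lab k).isSep) hq'
    have h₂ := blk_mono (sep := fun k => (lab k).isSep) (Nat.le_add_right q 1)
    rw [← ih (by omega) (by omega)]
    refine ((V.adj q hq).same ?_).2
    by_contra hs
    have := blk_lt (sep := fun k => (lab k).isSep) (Nat.lt_add_one q) le_rfl (by simpa using hs)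
    omega

open Classical in
/-- The number of units in the register `r` that enter the block `k`. -/
noncomputable def inCount (w : List (A × D)) (lab : ℕ → Label Q R) (k : ℕ) (r : R) : ℕ :=
  #{p ∈ range w.length | blk (fun j => (lab j).isSep) p = k ∧ (lab p).inMark = some r}

open Classical in
/-- The number of units in the register `r` that leave the block `k`. -/
noncomputable def outCount (w : List (A × D)) (lab : ℕ → Label Q R) (k : ℕ) (r : R) : ℕ :=
  #{p ∈ range w.length | blk (fun j => (lab j).isSep) p = k ∧ (lab p).outMark = some r}

open Classical in
/-- The number of elements of the block `k` for the register `r`. -/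
noncomputable def elemCount (w : List (A × D)) (lab : ℕ → Label Q R) (k : ℕ) (r : R) : ℕ :=
  #{p ∈ range w.length | blk (fun j => (lab j).isSep) p = k ∧ (lab p).kind = .elem r}

theorem inCount_eq_zero {k : ℕ} (h : ∀ p < w.length, β p ≠ k) : inCount w lab k = 0 := by
  classical
  funext r
  exact card_eq_zero.2 (filter_eq_empty_iff.2 fun p hp hp' => h p (mem_range.1 hp) hp'.1)

theorem outCount_eq_card {k : ℕ} {r : R} {S : Finset ℕ}
    (h : ∀ p, (p < w.length ∧ β p = k ∧ (lab p).outMark = some r) ↔ p ∈ S) :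
    outCount w lab k r = #S := by
  classical
  unfold outCount
  congr 1
  ext p
  rw [mem_filter, mem_range, h]

/-- `out` and `in'` give every marked position a partner in the adjacent block, and
`eq_of_sameClass` prevents two positions from sharing one. This yields both inequalities. -/
theorem outCount_eq_inCount (V : Valid M r₀ n w lab) (k : ℕ) :
    outCount w lab k = inCount w lab (k + 1) := by
  classical
  funext r
  apply le_antisymm
  · refine card_le_card_of_forall_subsingleton (SameClass w) ?_ ?_
    · intro p hp
      simp only [mem_filter, mem_range] at hp
      obtain ⟨q, hq, ⟨h₁, h₂⟩, h₃⟩ := V.out p hp.1 r hp.2.2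
      exact ⟨q, by simp [hq, h₂.blk_eq (Label.isSep_of_inMark h₃), hp.2.1, h₃], h₁⟩
    · rintro q - p ⟨hp, h⟩ p' ⟨hp', h'⟩
      simp only [mem_filter, mem_range] at hp hp'
      exact V.eq_of_sameClass (h.trans h'.symm) (hp.2.1.trans hp'.2.1.symm)
  · refine card_le_card_of_forall_subsingleton (fun q p => SameClass w p q) ?_ ?_
    · intro q hq
      simp only [mem_filter, mem_range] at hq
      obtain ⟨p, hp, ⟨h₁, h₂⟩, h₃⟩ := V.in' q hq.1 r hq.2.2
      have := h₂.blk_eq (Label.isSep_of_inMark hq.2.2)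
      exact ⟨p, by simp only [mem_filter, mem_range]; exact ⟨hp, by omega, h₃⟩, h₁⟩
    · rintro p - q ⟨hq, h⟩ q' ⟨hq', h'⟩
      simp only [mem_filter, mem_range] at hq hq'
      exact V.eq_of_sameClass (h.symm.trans h') (hq.2.1.trans hq'.2.1.symm)

theorem kind_ne_slot_zero (V : Valid M r₀ n w lab) : (lab 0).kind ≠ .slot := by
  simp [V.first]

section Block

variable {s : ℕ} {q : Q} {i : Instr R}

theorem op_eq_of_blk (V : Valid M r₀ n w lab) (hsep : (lab s).isSep = true)
    (hop : (lab s).op = some (q, i)) {p : ℕ} (hp : p < w.length) (hb : β p = β s) :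
    s ≤ p ∧ (lab p).op = some (q, i) := by
  have : s ≤ p := by
    by_contra h
    have := blk_lt (sep := fun k => (lab k).isSep) (not_le.1 h) le_rfl hsep
    omega
  exact ⟨this, (V.op_eq this hp hb).trans hop⟩

/-- A slot directly follows a separator, and `s` is the only separator of its block. -/
theorem slot_iff (V : Valid M r₀ n w lab) (hs : s < w.length) (hsep : (lab s).isSep = true) (p : ℕ) :
    (p < w.length ∧ β p = β s ∧ (lab p).kind = .slot) ↔ p = s + 1 := by
  have hs' := Label.isSep_iff.1 hsep
  have hlt : s + 1 < w.length := by
    by_contra h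
    exact (V.last s (by omega)).1 hs'
  constructor
  · rintro ⟨hp, hb, hk⟩
    obtain ⟨p, rfl⟩ : ∃ j, p = j + 1 :=
      ⟨p - 1, by
        have : p ≠ 0 := by rintro rfl; exact V.kind_ne_slot_zero hk
        omega⟩
    have hpk := Label.isSep_iff.2 ((V.adj p hp).slot_iff.1 hk)
    rcases lt_trichotomy p s with h | h | h
    · have := blk_lt (sep := fun k => (lab k).isSep) h le_rfl hsep
      rcases (show p + 1 ≤ s from h).eq_or_lt with h' | h'
      · rw [h', hs'] at hk
        cases hk
      · have := blk_lt (sep := fun k => (lab k).isSep) h' le_rfl hsep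
        omega
    · rw [h]
    · have := blk_lt (sep := fun k => (lab k).isSep) h (Nat.le_succ p) hpk
      simp only [Nat.succ_eq_add_one] at this
      omega
  · rintro rfl
    have hk := (V.adj s hlt).slot_iff.2 hs'
    refine ⟨hlt, ?_, hk⟩
    rw [blk_succ]
    simp [Label.isSep, hk]

-- Elements both enter and leave the block; only the slot makes a difference, and it enters exactly
-- when the instruction is a decrement.
open Classical in
theorem inCount_eq (V : Valid M r₀ n w lab) (hs : s < w.length) (hsep : (lab s).isSep = true)
    (hop : (lab s).op = some (q, i)) (r : R) :
    inCount w lab (β s) r = elemCount w lab (β s) r + if i = .dec r then 1 else 0 := by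
  have hslot := V.slot_iff hs hsep
  have hop' := fun p => V.op_eq_of_blk hsep hop (p := p)
  unfold inCount elemCount
  split_ifs with hi
  · rw [← card_insert_of_notMem (a := s + 1)]
    · congr 1
      ext p
      simp only [mem_filter, mem_range, mem_insert, Label.inMark_eq_some_iff, ← hslot p]
      constructor
      · rintro ⟨h₁, h₂, h₃ | ⟨_, _, h₃⟩⟩
        · exact Or.inr ⟨h₁, h₂, h₃.2⟩
        · exact Or.inl ⟨h₁, h₂, h₃⟩
      · rintro (⟨h₁, h₂, h₃⟩ | ⟨h₁, h₂, h₃⟩)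
        · exact ⟨h₁, h₂, Or.inr ⟨q, by rw [(hop' p h₁ h₂).2, hi], h₃⟩⟩
        · exact ⟨h₁, h₂, Or.inl ⟨by simp [(hop' p h₁ h₂).2], h₃⟩⟩
    · simp [((hslot (s + 1)).2 rfl).2.2]
  · rw [Nat.add_zero]
    congr 1
    ext p
    simp only [mem_filter, mem_range, Label.inMark_eq_some_iff]
    refine and_congr_right fun h₁ => and_congr_right fun h₂ => ?_
    simp [(hop' p h₁ h₂).2, hi]

open Classical in
theorem outCount_eq (V : Valid M r₀ n w lab) (hs : s < w.length) (hsep : (lab s).isSep = true)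
    (hop : (lab s).op = some (q, i)) (r : R) :
    outCount w lab (β s) r = elemCount w lab (β s) r + if i = .inc r then 1 else 0 := by
  have hslot := V.slot_iff hs hsep
  have hop' := fun p => V.op_eq_of_blk hsep hop (p := p)
  unfold outCount elemCount
  split_ifs with hi
  · rw [← card_insert_of_notMem (a := s + 1)]
    · congr 1
      ext p
      simp only [mem_filter, mem_range, mem_insert, Label.outMark_eq_some_iff, ← hslot p]
      constructor
      · rintro ⟨h₁, h₂, h₃ | ⟨_, _, h₃⟩⟩
        · exact Or.inr ⟨h₁, h₂, h₃⟩
        · exact Or.inl ⟨h₁, h₂, h₃⟩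
      · rintro (⟨h₁, h₂, h₃⟩ | ⟨h₁, h₂, h₃⟩)
        · exact ⟨h₁, h₂, Or.inr ⟨q, by rw [(hop' p h₁ h₂).2, hi], h₃⟩⟩
        · exact ⟨h₁, h₂, Or.inl h₃⟩
    · simp [((hslot (s + 1)).2 rfl).2.2]
  · rw [Nat.add_zero]
    congr 1
    ext p
    simp only [mem_filter, mem_range, Label.outMark_eq_some_iff]
    refine and_congr_right fun h₁ => and_congr_right fun h₂ => ?_
    simp [(hop' p h₁ h₂).2, hi]

theorem elemCount_zero (V : Valid M r₀ n w lab) {r : R} (hsep : (lab s).isSep = true)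
    (hop : (lab s).op = some (q, .zero r)) : elemCount w lab (β s) r = 0 := by
  classical
  refine card_eq_zero.2 (filter_eq_empty_iff.2 fun p hp => ?_)
  rintro ⟨hb, hk⟩
  rw [mem_range] at hp
  obtain ⟨p, rfl⟩ : ∃ j, p = j + 1 :=
    ⟨p - 1, by
      have : p ≠ 0 := by rintro rfl; simp [V.first] at hk
      omega⟩
  exact ((V.adj p hp).elem r hk).2 q (V.op_eq_of_blk hsep hop hp hb).2

/-- The units entering a block form the configuration before its instruction, and those leaving it
form the configuration after. The latter are the units entering the next block by
`outCount_eq_inCount`. -/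
theorem step [DecidableEq R] (V : Valid M r₀ n w lab) (hs : s < w.length)
    (hsep : (lab s).isSep = true) (hop : (lab s).op = some (q, i)) :
    i.Step (inCount w lab (β s)) (inCount w lab (β s + 1)) := by
  classical
  rw [← V.outCount_eq_inCount]
  have h₁ := V.inCount_eq hs hsep hop
  have h₂ := V.outCount_eq hs hsep hop
  cases i with
  | inc r =>
    funext r'
    rw [Function.update_apply, h₁, h₁, h₂]
    rcases eq_or_ne r' r with rfl | h
    · simp
    · simp [h, h.symm]
  | dec r =>
    funext r'
    rw [Function.update_apply, h₁, h₂, h₂]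
    rcases eq_or_ne r' r with rfl | h
    · simp
    · simp [h, h.symm]
  | zero r =>
    refine ⟨?_, funext fun r' => ?_⟩
    · rw [h₁, V.elemCount_zero hsep hop]
      simp
    · rw [h₁, h₂]
      simp

theorem exists_exec [DecidableEq R] (V : Valid M r₀ n w lab) (hs : s < w.length)
    (hsep : (lab s).isSep = true) (hop : (lab s).op = some (q, i)) :
    ∃ u, Exec u (inCount w lab (β s)) 0 ∧ M.evalFrom q u ∈ M.accept := by
  classical
  induction hm : w.length - s using Nat.strong_induction_on generalizing s q i with
  | _ m ih =>
  have hstep := V.step hs hsep hop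
  by_cases hex : ∃ s', s < s' ∧ s' < w.length ∧ (lab s').isSep = true
  · obtain ⟨h₁, h₂, h₃⟩ := Nat.find_spec hex
    have hmin : ∀ k, s < k → k < Nat.find hex → (lab k).isSep = false := by
      intro k hk hk'
      by_contra h
      exact Nat.find_min hex hk' ⟨hk, hk'.trans h₂, by simpa using h⟩
    generalize Nat.find hex = s' at *
    have hb : β s' = β s + 1 := by
      refine blk_eq_succ h₁ le_rfl h₃ fun j hj hj' hsj => ?_
      by_contra hne
      simp [hmin j hj (lt_of_le_of_ne hj' hne)] at hsj
    obtain ⟨t, rfl⟩ : ∃ t, s' = t + 1 := ⟨s' - 1, by omega⟩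
    have hot : (lab t).op = some (q, i) :=
      (V.op_eq (p := s) (by omega) (by omega)
        (blk_eq (by omega) fun k hk hk' => hmin k hk (by omega))).trans hop
    obtain ⟨-, i', hi'⟩ := (V.adj t h₂).sep h₃
    rw [hot] at hi'
    obtain ⟨u, hu, hu'⟩ := ih _ (by omega) h₂ h₃ hi' rfl
    rw [hb] at hu
    exact ⟨i :: u, ⟨_, hstep, hu⟩, hu'⟩
  · push Not at hex
    have hb : ∀ p, s ≤ p → p < w.length → β p = β s := fun p hp hp' =>
      blk_eq hp fun k hk hk' => by simpa using hex k hk (by omega)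
    -- No later block exists to receive units, so the last block emits none: the run must end with
    -- empty registers.
    have hzero : inCount w lab (β s + 1) = 0 := by
      refine inCount_eq_zero fun p hp hp' => ?_
      rcases le_total s p with h | h
      · have := hb p h hp
        omega
      · have := blk_mono (sep := fun k => (lab k).isSep) h
        omega
    obtain ⟨-, q', i', hop', hacc⟩ := V.last (w.length - 1) (by omega)
    rw [V.op_eq (p := s) (by omega) (by omega) (hb _ (by omega) (by omega)), hop] at hop'
    obtain ⟨rfl, rfl⟩ := Prod.mk.inj (Option.some.inj hop')
    exact ⟨[i], ⟨0, hzero ▸ hstep, rfl⟩, hacc⟩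

end Block

/-- The positions before `n + 2` are exactly the initial block. Its separator and slot pass on
nothing and its `n` elements belong to `r₀`, so the first instruction starts from the input
configuration. -/
theorem run [DecidableEq R] (V : Valid M r₀ n w lab) : Run M.accepts (Pi.single r₀ n) 0 := by
  classical
  have hlt := V.lt
  have hnosep : ∀ p, 0 < p → p < n + 2 → (lab p).isSep = false := by
    intro p hp hp'
    obtain ⟨p, rfl⟩ : ∃ j, p = j + 1 := ⟨p - 1, by omega⟩
    by_contra h
    obtain ⟨-, i, hi⟩ := (V.adj p (by omega)).sep (by simpa using h)
    simp [V.before _ hp'] at hi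
  have hsep : (lab (n + 2)).isSep = true := by
    by_contra h
    exact V.init ((((V.adj (n + 1) hlt).same (by simpa using h)).2).trans (V.before _ (by omega)))
  have hsep₀ : (lab 0).isSep = true := by simp [V.first, Label.isSep]
  obtain ⟨-, i, hi⟩ := (V.adj (n + 1) hlt).sep hsep
  rw [V.before (n + 1) (by omega)] at hi
  obtain ⟨u, hu, hacc⟩ := V.exists_exec hlt hsep hi
  refine ⟨u, hacc, ?_⟩
  have hb₁ : ∀ p, p < n + 2 → β p = β 0 := fun p hp =>
    blk_eq (Nat.zero_le p) fun k hk hk' => hnosep k hk (by omega)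
  have hb₂ : β (n + 2) = β 0 + 1 := by
    refine blk_eq_succ (by omega) le_rfl hsep fun j hj hj' hsj => ?_
    by_contra hne
    simp [hnosep j hj (by omega)] at hsj
  have hb₃ : ∀ p, n + 2 ≤ p → β p ≠ β 0 := fun p hp => by
    have := blk_mono (sep := fun k => (lab k).isSep) hp
    omega
  convert hu using 1
  funext r
  rw [hb₂, ← V.outCount_eq_inCount]
  have hslot := V.slot_iff (s := 0) (by omega) hsep₀
  have hkind : ∀ p, 2 ≤ p → p < n + 2 → (lab p).kind = .elem r₀ := by
    intro p hp hp'
    obtain ⟨p, rfl⟩ : ∃ j, p = j + 1 := ⟨p - 1, by omega⟩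
    cases hk : (lab (p + 1)).kind with
    | sep =>
      have := Label.isSep_iff.2 hk
      simp [hnosep (p + 1) (by omega) hp'] at this
    | slot =>
      have := (hslot (p + 1)).1 ⟨by omega, hb₁ _ hp', hk⟩
      omega
    | elem r => rw [((V.adj p (by omega)).elem r hk).1 (V.before _ hp')]
  have hout : ∀ p, p < w.length ∧ β p = β 0 ∧ (lab p).outMark = some r ↔
      2 ≤ p ∧ p < n + 2 ∧ r = r₀ := by
    intro p
    constructor
    · rintro ⟨h₁, h₂, h₃⟩
      have hp : p < n + 2 := by
        by_contra h
        exact hb₃ p (by omega) h₂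
      have hp₂ : 2 ≤ p := by
        by_contra h
        have : p = 0 ∨ p = 1 := by omega
        rcases this with rfl | rfl
        · simp [V.first, Label.outMark] at h₃
        · have := ((hslot 1).2 rfl).2.2
          simp [Label.outMark_eq_some_iff, V.before 1 hp, this] at h₃
      refine ⟨hp₂, hp, ?_⟩
      rcases Label.outMark_eq_some_iff.1 h₃ with h | ⟨_, h, _⟩
      · rw [hkind p hp₂ hp] at h
        cases h
        rfl
      · simp [V.before p hp] at h
    · rintro ⟨h₁, h₂, rfl⟩
      exact ⟨by omega, hb₁ p h₂, Label.outMark_eq_some_iff.2 (Or.inl (hkind p h₁ h₂))⟩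
  have hcard : outCount w lab (β 0) r = #(if r = r₀ then Ico 2 (n + 2) else ∅) := by
    refine outCount_eq_card fun p => (hout p).trans ?_
    split_ifs with h <;> simp [h]
  rw [hcard, Pi.single_apply]
  split_ifs <;> simp

end Valid

/-! ### From runs to data words -/

section Tokens

variable {R : Type*} [DecidableEq R]

/-- The units that remain when the instruction removes one. -/
def remTok : Instr R → List (ℕ × R) → List (ℕ × R)
  | .dec r, t => t.eraseP fun x => x.2 = r
  | _, t => t

/-- The units after an instruction, where `a` is the name of a new unit. -/
def nextTok (i : Instr R) (a : ℕ) (t : List (ℕ × R)) : List (ℕ × R) :=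
  match i with
  | .inc r => (a, r) :: t
  | i => remTok i t

/-- The name of the unit in the slot. -/
def slotTok (i : Instr R) (a : ℕ) (t : List (ℕ × R)) : ℕ :=
  match i with
  | .dec r => ((t.find? fun x => x.2 = r).map Prod.fst).getD a
  | _ => a

/-- `find?` and `eraseP` pick the same unit, the first one in register `r`. -/
theorem perm_slotTok_cons {t : List (ℕ × R)} {r : R} (h : ∃ x ∈ t, x.2 = r) (a : ℕ) :
    t.Perm ((slotTok (.dec r) a t, r) :: remTok (.dec r) t) := by
  obtain ⟨x, hx, hr⟩ := h
  obtain ⟨y, l₁, l₂, h₁, h₂, rfl, h₄⟩ := List.exists_of_eraseP (p := fun x : ℕ × R => x.2 = r) hx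
    (by simpa using hr)
  have h₂ : y.2 = r := by simpa using h₂
  have h₅ : (l₁ ++ y :: l₂).find? (fun x => x.2 = r) = some y := by
    rw [List.find?_append, List.find?_eq_none.2 h₁]
    simp [h₂]
  rw [remTok, slotTok, h₄, h₅]
  obtain ⟨b, s⟩ := y
  obtain rfl : s = r := h₂
  exact List.perm_middle

variable (r₀ : R) (n : ℕ) (u : List (Instr R))

/-- The instruction with number `k`. -/
def opAt (k : ℕ) : Instr R := u[k]?.getD (.zero r₀)

/-- The units stored in the registers after `k` instructions. -/
def toks : ℕ → List (ℕ × R)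
  | 0 => (List.range n).map fun a => (a, r₀)
  | k + 1 => nextTok (opAt r₀ u k) (n + (k + 1)) (toks k)

/-- The elements of the block `k`. -/
def elems : ℕ → List (ℕ × R)
  | 0 => toks r₀ n u 0
  | k + 1 => remTok (opAt r₀ u k) (toks r₀ n u k)

/-- The name of the unit in the slot of the block `k`. -/
def slotAt : ℕ → ℕ
  | 0 => n
  | k + 1 => slotTok (opAt r₀ u k) (n + (k + 1)) (toks r₀ n u k)

/-- The names of the units in the block `k`. -/
def ids (k : ℕ) : List ℕ := slotAt r₀ n u k :: (elems r₀ n u k).map Prod.fst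

/-- The roles of the positions of the block `k`. -/
def kinds (k : ℕ) : List (Kind R) := .slot :: (elems r₀ n u k).map fun x => .elem x.2

/-- The name of the unit at the position `i` of the block `k`. -/
def idAt (k i : ℕ) : ℕ ⊕ ℕ :=
  match i with
  | 0 => .inl k
  | i + 1 => .inr ((ids r₀ n u k)[i]?.getD 0)

variable {Q : Type*} (M : DFA (Instr R) Q)

/-- The label of the position `i` of the block `k`. -/
def labelAt (k i : ℕ) : Label Q R where
  par := k % 2 == 0
  op := match k with
    | 0 => none
    | k + 1 => some (M.eval (u.take k), opAt r₀ u k)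
  kind := match i with
    | 0 => .sep
    | i + 1 => (kinds r₀ n u k)[i]?.getD .slot

variable {r₀ n u M}

theorem isSep_labelAt {k i : ℕ} : (labelAt r₀ n u M k i).isSep = true ↔ i = 0 := by
  rw [Label.isSep_iff]
  simp only [labelAt]
  cases i with
  | zero => simp
  | succ i =>
    cases i with
    | zero => simp [kinds]
    | succ i =>
      simp only [kinds, List.getElem?_cons_succ, List.getElem?_map]
      cases (elems r₀ n u k)[i]? <;> simp

/-- The bound on `i` excludes the default value `.slot` beyond the end of the block. -/
theorem kind_labelAt_eq_slot {k i : ℕ} (hi : i ≤ (ids r₀ n u k).length) :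
    (labelAt r₀ n u M k i).kind = .slot ↔ i = 1 := by
  simp only [labelAt]
  match i, hi with
  | 0, _ => simp
  | 1, _ => simp [kinds]
  | i + 2, hi =>
    have : i < (elems r₀ n u k).length := by simp [ids] at hi; omega
    simp [kinds, this]

theorem kind_labelAt_eq_elem {k i : ℕ} (hi : i ≤ (ids r₀ n u k).length) {r : R} :
    (labelAt r₀ n u M k i).kind = .elem r ↔
      0 < i ∧ ∃ a, (a, r) ∈ elems r₀ n u k ∧ idAt r₀ n u k i = .inr a ∧
        ∃ j, i = j + 2 ∧ (elems r₀ n u k)[j]? = some (a, r) := by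
  simp only [labelAt]
  match i, hi with
  | 0, _ => simp
  | 1, _ => simp [kinds]
  | i + 2, hi =>
    have : i < (elems r₀ n u k).length := by simp [ids] at hi; omega
    simp only [kinds, List.getElem?_cons_succ, List.getElem?_map, idAt, ids,
      List.getElem?_eq_getElem this, Option.map_some, Option.getD_some]
    constructor
    · intro h
      refine ⟨by omega, (elems r₀ n u k)[i].1, ?_, rfl, i, rfl, ?_⟩
      · rw [← Kind.elem.inj h]
        exact List.getElem_mem _
      · rw [List.getElem?_eq_getElem this, ← Kind.elem.inj h]
    · rintro ⟨-, a, -, -, j, hj, h⟩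
      obtain rfl : i = j := by omega
      rw [List.getElem?_eq_getElem this] at h
      rw [Option.some.inj h]

theorem exists_idAt_of_mem_elems {k a : ℕ} {r : R} (h : (a, r) ∈ elems r₀ n u k) :
    ∃ i, i ≤ (ids r₀ n u k).length ∧ (labelAt r₀ n u M k i).kind = .elem r ∧
      idAt r₀ n u k i = .inr a := by
  obtain ⟨j, hj⟩ := List.getElem?_of_mem h
  have hlt := (List.getElem?_eq_some_iff.1 hj).1
  have hle : j + 2 ≤ (ids r₀ n u k).length := by simp [ids]; omega
  have : idAt r₀ n u k (j + 2) = .inr a := by simp [idAt, ids, hj]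
  exact ⟨j + 2, hle, (kind_labelAt_eq_elem hle).2 ⟨by omega, a, h, this, j, rfl, hj⟩, this⟩

end Tokens

/-- The units stored after each step of a terminating execution are consistent. -/
structure Consistent {R : Type*} [DecidableEq R] (r₀ : R) (n : ℕ) (u : List (Instr R)) : Prop where
  nodup : ∀ k ≤ u.length, ((toks r₀ n u k).map Prod.fst).Nodup
  lt : ∀ k ≤ u.length, ∀ x ∈ toks r₀ n u k, x.1 < n + k + 1
  dec : ∀ k < u.length, ∀ r, opAt r₀ u k = .dec r → ∃ x ∈ toks r₀ n u k, x.2 = r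
  zero : ∀ k < u.length, ∀ r, opAt r₀ u k = .zero r → ∀ x ∈ toks r₀ n u k, x.2 ≠ r
  nil : toks r₀ n u u.length = []

section Consistent

variable {R : Type*} [DecidableEq R] {r₀ : R} {n : ℕ} {u : List (Instr R)}

/-- Invariant along the run: the listed units realize the current configuration, from which the
remaining instructions still lead to `0`. -/
theorem exists_exec_drop (h : Exec u (Pi.single r₀ n) 0) (k : ℕ) (hk : k ≤ u.length) :
    ∃ c, Exec (u.drop k) c 0 ∧ ∀ r, ((toks r₀ n u k).map Prod.snd).count r = c r := by
  induction k with
  | zero =>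
    refine ⟨_, h, fun r => ?_⟩
    rw [toks, List.map_map, Pi.single_apply, show Prod.snd ∘ (fun a : ℕ => (a, r₀)) = fun _ => r₀
      from rfl, List.map_const', List.count_replicate, List.length_range]
    rcases eq_or_ne r r₀ with rfl | h
    · simp
    · simp [h, h.symm]
  | succ k ih =>
    obtain ⟨c, hc, hcount⟩ := ih (by omega)
    have hop : opAt r₀ u k = u[k] := by simp [opAt, List.getElem?_eq_getElem hk]
    rw [List.drop_eq_getElem_cons hk, ← hop] at hc
    obtain ⟨μ, hμ, hex⟩ := hc
    refine ⟨μ, hex, fun r => ?_⟩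
    rw [toks]
    cases hi : opAt r₀ u k with
    | inc s =>
      rw [hi, Instr.Step] at hμ
      rw [nextTok, List.map_cons, List.count_cons, hcount, hμ, Function.update_apply]
      rcases eq_or_ne r s with rfl | h
      · simp
      · simp [h, h.symm]
    | dec s =>
      rw [hi, Instr.Step] at hμ
      have hmem : s ∈ (toks r₀ n u k).map Prod.snd := by
        rw [← List.count_pos_iff, hcount, hμ]
        simp
      obtain ⟨x, hx, hxs⟩ := List.mem_map.1 hmem
      -- The fallback name `0` is never used, as a unit of register `s` exists.
      have hp := ((perm_slotTok_cons ⟨x, hx, hxs⟩ 0).map Prod.snd).count_eq r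
      rw [List.map_cons, List.count_cons, hcount, hμ, Function.update_apply] at hp
      rw [nextTok]
      · rcases eq_or_ne r s with rfl | h
        · simp at hp
          omega
        · simp [h, h.symm] at hp
          omega
      · simp
    | zero s =>
      rw [hi] at hμ
      rw [hμ.2, ← hcount]
      rfl

/-- Decrements and zero tests are justified by the counts from `exists_exec_drop`. Names stay
distinct because the initial ones are below `n` and step `k + 1` can only introduce `n + (k + 1)`,
which exceeds all names present. -/
theorem consistent_of_exec (h : Exec u (Pi.single r₀ n) 0) : Consistent r₀ n u := by
  have hdec : ∀ k < u.length, ∀ r, opAt r₀ u k = .dec r → ∃ x ∈ toks r₀ n u k, x.2 = r := by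
    intro k hk r hr
    obtain ⟨c, hc, hcount⟩ := exists_exec_drop h k hk.le
    have hop : opAt r₀ u k = u[k] := by simp [opAt, List.getElem?_eq_getElem hk]
    rw [List.drop_eq_getElem_cons hk, ← hop, hr] at hc
    obtain ⟨μ, hμ, -⟩ := hc
    rw [Instr.Step] at hμ
    have hmem : r ∈ (toks r₀ n u k).map Prod.snd := by
      rw [← List.count_pos_iff, hcount, hμ]
      simp
    exact List.mem_map.1 hmem
  have hnl : ∀ k ≤ u.length, ((toks r₀ n u k).map Prod.fst).Nodup ∧
      ∀ x ∈ toks r₀ n u k, x.1 < n + k + 1 := by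
    intro k hk
    induction k with
    | zero =>
      constructor
      · rw [toks, List.map_map]
        exact List.nodup_range.map fun _ _ h => h
      · intro x hx
        obtain ⟨a, ha, rfl⟩ := List.mem_map.1 hx
        have := List.mem_range.1 ha
        simp only
        omega
    | succ k ih =>
      obtain ⟨ih₁, ih₂⟩ := ih (by omega)
      rw [toks]
      cases hi : opAt r₀ u k with
      | inc s =>
        rw [nextTok, List.map_cons, List.nodup_cons]
        refine ⟨⟨fun hmem => ?_, ih₁⟩, ?_⟩
        · obtain ⟨x, hx, hx'⟩ := List.mem_map.1 hmem
          have := ih₂ x hx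
          omega
        · intro x hx
          rcases List.mem_cons.1 hx with rfl | hx
          · simp only
            omega
          · have := ih₂ x hx
            omega
      | dec s =>
        have hp := perm_slotTok_cons (hdec k hk s hi) 0
        rw [nextTok]
        · constructor
          · have := (hp.map Prod.fst).nodup_iff.1 ih₁
            exact (List.nodup_cons.1 this).2
          · intro x hx
            have := ih₂ x (hp.mem_iff.2 (List.mem_cons_of_mem _ hx))
            omega
        · simp
      | zero s =>
        refine ⟨ih₁, fun x hx => ?_⟩
        have := ih₂ x hx
        omega
  refine ⟨fun k hk => (hnl k hk).1, fun k hk => (hnl k hk).2, hdec, ?_, ?_⟩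
  · rintro k hk r hr ⟨a, r⟩ hx rfl
    obtain ⟨c, hc, hcount⟩ := exists_exec_drop h k hk.le
    have hop : opAt r₀ u k = u[k] := by simp [opAt, List.getElem?_eq_getElem hk]
    rw [List.drop_eq_getElem_cons hk, ← hop, hr] at hc
    obtain ⟨μ, hμ, -⟩ := hc
    have := List.count_pos_iff.2 (List.mem_map_of_mem (f := Prod.snd) hx)
    rw [hcount, hμ.1] at this
    exact lt_irrefl _ this
  · obtain ⟨c, hc, hcount⟩ := exists_exec_drop h u.length le_rfl
    rw [List.drop_length] at hc
    cases hc
    rw [← List.map_eq_nil_iff (f := Prod.snd), List.eq_nil_iff_forall_not_mem]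
    intro r hr
    have := List.count_pos_iff.2 hr
    rw [hcount] at this
    exact lt_irrefl _ this

/-- With `exists_outMark`, this identifies the units leaving block `k` with `toks` at `k`. Its
counterparts for `inMark` identify the same list with the units entering block `k + 1`. -/
theorem mem_toks_of_outMark {Q : Type*} {M : DFA (Instr R) Q} {k i : ℕ}
    (hi : i ≤ (ids r₀ n u k).length)
    {r : R} (h : (labelAt r₀ n u M k i).outMark = some r) :
    ∃ a, (a, r) ∈ toks r₀ n u k ∧ idAt r₀ n u k i = .inr a := by
  rcases Label.outMark_eq_some_iff.1 h with h | ⟨q, h₁, h₂⟩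
  · obtain ⟨-, a, ha, hid, -⟩ := (kind_labelAt_eq_elem hi).1 h
    refine ⟨a, ?_, hid⟩
    cases k with
    | zero => exact ha
    | succ k =>
      rw [elems] at ha
      rw [toks]
      cases hop : opAt r₀ u k <;> rw [hop] at ha
      · exact List.mem_cons_of_mem _ ha
      · exact ha
      · exact ha
  · rw [kind_labelAt_eq_slot hi] at h₂
    subst h₂
    cases k with
    | zero => simp [labelAt] at h₁
    | succ k =>
      simp only [labelAt, Option.some.injEq, Prod.mk.injEq] at h₁
      refine ⟨_, ?_, rfl⟩
      simp [ids, slotAt, toks, h₁.2, nextTok, slotTok]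

theorem exists_outMark {Q : Type*} {M : DFA (Instr R) Q} {k a : ℕ} {r : R}
    (h : (a, r) ∈ toks r₀ n u k) : ∃ i, i ≤ (ids r₀ n u k).length ∧
      (labelAt r₀ n u M k i).outMark = some r ∧ idAt r₀ n u k i = .inr a := by
  have key : (a, r) ∈ elems r₀ n u k → ∃ i, i ≤ (ids r₀ n u k).length ∧
      (labelAt r₀ n u M k i).outMark = some r ∧ idAt r₀ n u k i = .inr a := by
    intro h
    obtain ⟨i, h₁, h₂, h₃⟩ := exists_idAt_of_mem_elems (M := M) h
    exact ⟨i, h₁, Label.outMark_eq_some_iff.2 (Or.inl h₂), h₃⟩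
  cases k with
  | zero => exact key h
  | succ k =>
    rw [toks] at h
    cases hop : opAt r₀ u k with
    | inc s =>
      rw [hop, nextTok] at h
      rcases List.mem_cons.1 h with h | h
      · obtain ⟨rfl, rfl⟩ := Prod.mk.inj h
        refine ⟨1, by simp [ids], Label.outMark_eq_some_iff.2 (Or.inr
          ⟨M.eval (u.take k), ?_, ?_⟩), ?_⟩
        · simp [labelAt, hop]
        · simp [labelAt, kinds]
        · simp [idAt, ids, slotAt, slotTok, hop]
      · exact key (by rw [elems, hop]; exact h)
    | dec s => exact key (by rw [elems]; rw [hop] at h ⊢; exact h)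
    | zero s => exact key (by rw [elems]; rw [hop] at h ⊢; exact h)

namespace Consistent

variable {Q : Type*} {M : DFA (Instr R) Q} {k i : ℕ}

/-- Either the slot takes over the unit removed by a decrement, or all units persist as elements and
the slot has a fresh name. -/
theorem perm_toks (C : Consistent r₀ n u) (hk : k < u.length) :
    (∃ r, opAt r₀ u k = .dec r ∧
      (toks r₀ n u k).Perm ((slotAt r₀ n u (k + 1), r) :: elems r₀ n u (k + 1))) ∨
    (∀ r, opAt r₀ u k ≠ .dec r) ∧ elems r₀ n u (k + 1) = toks r₀ n u k ∧
      slotAt r₀ n u (k + 1) = n + (k + 1) := by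
  rw [elems, slotAt]
  cases hi : opAt r₀ u k with
  | inc r => exact Or.inr ⟨by simp, rfl, rfl⟩
  | dec r => exact Or.inl ⟨r, rfl, perm_slotTok_cons (C.dec k hk r hi) _⟩
  | zero r => exact Or.inr ⟨by simp, rfl, rfl⟩

theorem nodup_ids (C : Consistent r₀ n u) (hk : k ≤ u.length) :
    (ids r₀ n u k).Nodup ∧ ∀ a ∈ ids r₀ n u k, a < n + k + 1 := by
  cases k with
  | zero =>
    simp only [ids, slotAt, elems, List.nodup_cons, List.mem_cons, forall_eq_or_imp]
    refine ⟨⟨?_, C.nodup 0 hk⟩, by omega, ?_⟩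
    · simp [toks]
    · rintro a ha
      obtain ⟨x, hx, rfl⟩ := List.mem_map.1 ha
      exact C.lt 0 hk x hx
  | succ k =>
    have h₁ := C.nodup k (by omega)
    have h₂ := C.lt k (by omega)
    rcases C.perm_toks hk with ⟨r, -, hp⟩ | ⟨-, h₃, h₄⟩
    · refine ⟨(hp.map Prod.fst).nodup_iff.1 h₁, fun a ha => ?_⟩
      obtain ⟨x, hx, rfl⟩ := List.mem_map.1 ((hp.map Prod.fst).mem_iff.2 ha)
      have := h₂ x hx
      omega
    · simp only [ids, h₃, h₄, List.nodup_cons, List.mem_cons, forall_eq_or_imp]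
      refine ⟨⟨fun hmem => ?_, h₁⟩, by omega, fun a ha => ?_⟩
      · obtain ⟨x, hx, hx'⟩ := List.mem_map.1 hmem
        have := h₂ x hx
        omega
      · obtain ⟨x, hx, rfl⟩ := List.mem_map.1 ha
        have := h₂ x hx
        omega

theorem mem_toks_of_inMark (C : Consistent r₀ n u) (hk : k < u.length)
    (hi : i ≤ (ids r₀ n u (k + 1)).length) {r : R}
    (h : (labelAt r₀ n u M (k + 1) i).inMark = some r) :
    ∃ a, (a, r) ∈ toks r₀ n u k ∧ idAt r₀ n u (k + 1) i = .inr a := by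
  rcases Label.inMark_eq_some_iff.1 h with ⟨-, h⟩ | ⟨q, h₁, h₂⟩
  · obtain ⟨-, a, ha, hid, -⟩ := (kind_labelAt_eq_elem hi).1 h
    refine ⟨a, ?_, hid⟩
    rcases C.perm_toks hk with ⟨r, -, hp⟩ | ⟨-, h₃, h₄⟩
    · exact hp.mem_iff.2 (List.mem_cons_of_mem _ ha)
    · exact h₃ ▸ ha
  · rw [kind_labelAt_eq_slot hi] at h₂
    subst h₂
    simp only [labelAt, Option.some.injEq, Prod.mk.injEq] at h₁
    refine ⟨slotAt r₀ n u (k + 1), ?_, rfl⟩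
    rcases C.perm_toks hk with ⟨s, hs, hp⟩ | ⟨hs, -⟩
    · rw [h₁.2] at hs
      cases hs
      exact hp.mem_iff.2 List.mem_cons_self
    · exact absurd h₁.2 (hs r)

theorem exists_inMark (C : Consistent r₀ n u) (hk : k < u.length) {a : ℕ} {r : R}
    (h : (a, r) ∈ toks r₀ n u k) : ∃ i, i ≤ (ids r₀ n u (k + 1)).length ∧
      (labelAt r₀ n u M (k + 1) i).inMark = some r ∧ idAt r₀ n u (k + 1) i = .inr a := by
  have key : (a, r) ∈ elems r₀ n u (k + 1) → ∃ i, i ≤ (ids r₀ n u (k + 1)).length ∧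
      (labelAt r₀ n u M (k + 1) i).inMark = some r ∧ idAt r₀ n u (k + 1) i = .inr a := by
    intro h
    obtain ⟨i, h₁, h₂, h₃⟩ := exists_idAt_of_mem_elems (M := M) h
    exact ⟨i, h₁, Label.inMark_eq_some_iff.2 (Or.inl ⟨by simp [labelAt], h₂⟩), h₃⟩
  rcases C.perm_toks hk with ⟨s, hs, hp⟩ | ⟨-, h₃, -⟩
  · rcases List.mem_cons.1 (hp.mem_iff.1 h) with h | h
    · obtain ⟨rfl, rfl⟩ := Prod.mk.inj h
      refine ⟨1, by simp [ids], Label.inMark_eq_some_iff.2 (Or.inr ⟨M.eval (u.take k), ?_, ?_⟩), ?_⟩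
      · simp [labelAt, hs]
      · simp [labelAt, kinds]
      · simp [idAt, ids]
    · exact key h
  · exact key (h₃ ▸ h)

/-- Such a position is a slot outside a decrement block. Its name occurs in no earlier block, so its
class begins here. -/
theorem idAt_of_inMark_eq_none (C : Consistent r₀ n u) (hk : k < u.length) (hi₀ : 0 < i)
    (hi : i ≤ (ids r₀ n u (k + 1)).length) (h : (labelAt r₀ n u M (k + 1) i).inMark = none) :
    idAt r₀ n u (k + 1) i = .inr (n + (k + 1)) := by
  have hop : (labelAt r₀ n u M (k + 1) i).op = some (M.eval (u.take k), opAt r₀ u k) := rfl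
  cases hkind : (labelAt r₀ n u M (k + 1) i).kind with
  | sep =>
    rw [← Label.isSep_iff, isSep_labelAt] at hkind
    omega
  | slot =>
    have hi := (kind_labelAt_eq_slot hi).1 hkind
    subst hi
    rcases C.perm_toks hk with ⟨s, hs, -⟩ | ⟨-, -, h₃⟩
    · rw [Label.inMark_eq_some_iff (r := s) |>.2 (Or.inr ⟨_, by rw [hop, hs], hkind⟩)] at h
      cases h
    · simp [idAt, ids, h₃]
  | elem r =>
    rw [Label.inMark_eq_some_iff (r := r) |>.2 (Or.inl ⟨by simp [hop], hkind⟩)] at h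
    cases h

theorem exists_idAt_eq (C : Consistent r₀ n u) (hk : k ≤ u.length) (hi₀ : 0 < i)
    (hi : i ≤ (ids r₀ n u k).length) : ∃ a < n + k + 1, idAt r₀ n u k i = .inr a := by
  obtain ⟨i, rfl⟩ : ∃ j, i = j + 1 := ⟨i - 1, by omega⟩
  refine ⟨(ids r₀ n u k)[i], (C.nodup_ids hk).2 _ (List.getElem_mem _), ?_⟩
  simp [idAt, List.getElem?_eq_getElem (show i < (ids r₀ n u k).length from hi)]

theorem eq_of_idAt_eq (C : Consistent r₀ n u) (hk : k ≤ u.length) {j : ℕ}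
    (hi : i ≤ (ids r₀ n u k).length) (hj : j ≤ (ids r₀ n u k).length)
    (h : idAt r₀ n u k i = idAt r₀ n u k j) : i = j := by
  match i, j, hi, hj, h with
  | 0, 0, _, _, _ => rfl
  | 0, j + 1, _, _, h => simp [idAt] at h
  | i + 1, 0, _, _, h => simp [idAt] at h
  | i + 1, j + 1, hi, hj, h =>
    simp only [idAt, List.getElem?_eq_getElem (show i < (ids r₀ n u k).length from hi),
      List.getElem?_eq_getElem (show j < (ids r₀ n u k).length from hj), Option.getD_some,
      Sum.inr.injEq] at h
    rw [((C.nodup_ids hk).1.getElem_inj_iff).1 h]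

end Consistent

end Consistent

section WordOf

variable {A D : Type*} {N : ℕ} {letter : ℕ → A} {dat : ℕ → D}

/-- The data word of length `N` with given letters and data values. -/
def wordOf (N : ℕ) (letter : ℕ → A) (dat : ℕ → D) : List (A × D) :=
  (List.range N).map fun p => (letter p, dat p)

@[simp]
theorem length_wordOf : (wordOf N letter dat).length = N := by simp [wordOf]

theorem getElem?_wordOf {p : ℕ} (hp : p < N) :
    (wordOf N letter dat)[p]? = some (letter p, dat p) := by
  simp [wordOf, List.getElem?_range hp]

theorem hasLabel_wordOf {p : ℕ} (hp : p < N) : HasLabel (wordOf N letter dat) (letter p) p := by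
  simp [HasLabel, getElem?_wordOf hp]

theorem sameClass_wordOf {p q : ℕ} (hp : p < N) (hq : q < N) :
    SameClass (wordOf N letter dat) p q ↔ dat p = dat q := by
  simp [SameClass, getElem?_wordOf hp, getElem?_wordOf hq, eq_comm]

end WordOf

/-! ### Arrangement of the blocks on the natural numbers. -/

section Positions

variable {R : Type*} [DecidableEq R] (r₀ : R) (n : ℕ) (u : List (Instr R))

/-- The first position of the block `k`. -/
def start : ℕ → ℕ
  | 0 => 0
  | k + 1 => start k + (ids r₀ n u k).length + 1

variable {r₀ n u}

theorem start_lt {k l : ℕ} (h : k < l) : start r₀ n u k + (ids r₀ n u k).length < start r₀ n u l := by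
  induction l, h using Nat.le_induction with
  | base => rw [start]; omega
  | succ l _ ih => rw [start]; omega

/-- The order of positions is lexicographic in the block and the place inside it. -/
theorem start_lt_iff {k l i j : ℕ} (hi : i ≤ (ids r₀ n u k).length)
    (hj : j ≤ (ids r₀ n u l).length) :
    start r₀ n u k + i < start r₀ n u l + j ↔ k < l ∨ k = l ∧ i < j := by
  rcases lt_trichotomy k l with h | rfl | h
  · have := start_lt (r₀ := r₀) (n := n) (u := u) h
    omega
  · omega
  · have := start_lt (r₀ := r₀) (n := n) (u := u) h
    omega

variable (r₀ n u) in
theorem exists_start (p : ℕ) :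
    ∃ x : ℕ × ℕ, x.2 ≤ (ids r₀ n u x.1).length ∧ p = start r₀ n u x.1 + x.2 := by
  induction p with
  | zero => exact ⟨(0, 0), Nat.zero_le _, rfl⟩
  | succ p ih =>
    obtain ⟨⟨k, i⟩, hi, rfl⟩ := ih
    rcases hi.lt_or_eq with h | h
    · exact ⟨(k, i + 1), h, by simp [add_assoc]⟩
    · exact ⟨(k + 1, 0), Nat.zero_le _, by simp only at h; simp only [h, start, Nat.add_zero]⟩

variable (r₀ n u) in
/-- The block of a position and the place in the block. -/
noncomputable def place (p : ℕ) : ℕ × ℕ := (exists_start r₀ n u p).choose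

theorem place_start {k i : ℕ} (hi : i ≤ (ids r₀ n u k).length) :
    place r₀ n u (start r₀ n u k + i) = (k, i) := by
  have key : ∀ x : ℕ × ℕ, x.2 ≤ (ids r₀ n u x.1).length →
      start r₀ n u k + i = start r₀ n u x.1 + x.2 → x = (k, i) := by
    intro x h₁ h₂
    have h₃ := start_lt_iff hi h₁
    have h₄ := start_lt_iff h₁ hi
    ext
    · simp only; omega
    · simp only; omega
  obtain ⟨h₁, h₂⟩ := (exists_start r₀ n u (start r₀ n u k + i)).choose_spec
  exact key _ h₁ h₂

end Positions

/-! ### The data word of a terminating execution. -/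

section Completeness

variable {R Q : Type*} [DecidableEq R] {r₀ : R} {n : ℕ} {u : List (Instr R)} {M : DFA (Instr R) Q}
  {k i : ℕ}

theorem nextState_op_labelAt (hk : k ≤ u.length) :
    Label.nextState M (labelAt r₀ n u M k i).op = M.eval (u.take k) := by
  cases k with
  | zero => rfl
  | succ k =>
    rw [← List.take_append_getElem hk, DFA.eval_append_singleton]
    simp [labelAt, Label.nextState, opAt, List.getElem?_eq_getElem hk]

theorem Consistent.adj_labelAt (C : Consistent r₀ n u) (hk : k ≤ u.length)
    (hi : i + 1 ≤ (ids r₀ n u k).length) :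
    (labelAt r₀ n u M k i).Adj M r₀ (labelAt r₀ n u M k (i + 1)) where
  slot_iff := by
    rw [kind_labelAt_eq_slot hi, ← Label.isSep_iff, isSep_labelAt]
    omega
  same _ := ⟨rfl, rfl⟩
  sep h := by simp [isSep_labelAt] at h
  elem r h := by
    obtain ⟨-, a, ha, -⟩ := (kind_labelAt_eq_elem hi).1 h
    cases k with
    | zero =>
      refine ⟨fun _ => ?_, by simp [labelAt]⟩
      rw [elems, toks] at ha
      obtain ⟨b, -, hb⟩ := List.mem_map.1 ha
      exact (Prod.mk.inj hb).2.symm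
    | succ k =>
      refine ⟨by simp [labelAt], fun q hq => ?_⟩
      simp only [labelAt, Option.some.injEq, Prod.mk.injEq] at hq
      rw [elems, hq.2] at ha
      exact C.zero k hk r hq.2 _ ha rfl

theorem adj_labelAt_succ (hk : k ≤ u.length) :
    (labelAt r₀ n u M k (ids r₀ n u k).length).Adj M r₀ (labelAt r₀ n u M (k + 1) 0) where
  slot_iff := by
    rw [← Label.isSep_iff, isSep_labelAt]
    simp [labelAt, ids]
  same h := by
    rw [Bool.eq_false_iff] at h
    exact absurd (isSep_labelAt.2 rfl) h
  sep _ := by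
    refine ⟨?_, opAt r₀ u k, ?_⟩
    · simp only [labelAt]
      rcases Nat.mod_two_eq_zero_or_one k with h | h <;> simp [Nat.add_mod, h]
    · rw [nextState_op_labelAt hk]
      rfl
  elem r h := by simp [labelAt] at h

/-- A terminating execution is encoded by a data word. -/
theorem exists_valid {A D : Type*} [Infinite D] (letter : Label Q R → A) (hu : u ≠ [])
    (hacc : u ∈ M.accepts) (hex : Exec u (Pi.single r₀ n) 0) :
    ∃ (w : List (A × D)) (lab : ℕ → Label Q R), Valid M r₀ n w lab ∧
      ∀ p < w.length, HasLabel w (letter (lab p)) p := by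
  have C := consistent_of_exec hex
  -- The left summand supplies values for the separators, each alone in its class; the right summand
  -- supplies the names of units.
  obtain ⟨ι⟩ : Nonempty (ℕ ⊕ ℕ ↪ D) :=
    ⟨(Denumerable.eqv (ℕ ⊕ ℕ)).toEmbedding.trans (Infinite.natEmbedding D)⟩
  set S := start r₀ n u with hS
  set N := S (u.length + 1) with hN
  set lab : ℕ → Label Q R := fun p => labelAt r₀ n u M (place r₀ n u p).1 (place r₀ n u p).2 with hlab
  set dat : ℕ → ℕ ⊕ ℕ := fun p => idAt r₀ n u (place r₀ n u p).1 (place r₀ n u p).2 with hdat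
  have hlab' : ∀ {k i}, i ≤ (ids r₀ n u k).length → lab (S k + i) = labelAt r₀ n u M k i :=
    fun hi => by simp only [hlab, hS, place_start hi]
  have hdat' : ∀ {k i}, i ≤ (ids r₀ n u k).length → dat (S k + i) = idAt r₀ n u k i :=
    fun hi => by simp only [hdat, hS, place_start hi]
  have hlt : ∀ {k i}, i ≤ (ids r₀ n u k).length → (S k + i < N ↔ k ≤ u.length) := fun {k i} hi => by
    rw [hN, ← Nat.add_zero (S (u.length + 1)), hS, start_lt_iff hi (Nat.zero_le _)]
    omega
  have hpos : ∀ p < N, ∃ k i, k ≤ u.length ∧ i ≤ (ids r₀ n u k).length ∧ p = S k + i := by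
    intro p hp
    obtain ⟨⟨k, i⟩, hi, rfl⟩ := exists_start r₀ n u p
    exact ⟨k, i, (hlt hi).1 hp, hi, rfl⟩
  have hsep : ∀ {k i j}, i ≤ (ids r₀ n u k).length → j ≤ (ids r₀ n u (k + 1)).length → 0 < j →
      OneSep (fun p => (lab p).isSep) (S k + i) (S (k + 1) + j) := by
    intro k i j hi hj hj₀
    have h₁ : S k + i < S (k + 1) + 0 :=
      (start_lt_iff hi (Nat.zero_le _)).2 (Or.inl k.lt_succ_self)
    refine ⟨by omega, S (k + 1) + 0, ⟨h₁, by omega, ?_⟩, ?_⟩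
    · beta_reduce
      rw [hlab' (Nat.zero_le _), isSep_labelAt]
    · rintro m ⟨hm₁, hm₂, hm₃⟩
      obtain ⟨⟨l, t⟩, ht, rfl⟩ := exists_start r₀ n u m
      simp only at ht hm₁ hm₂ hm₃ ⊢
      rw [hlab' ht, isSep_labelAt] at hm₃
      subst hm₃
      rw [start_lt_iff hi ht] at hm₁
      rw [start_lt_iff ht hj] at hm₂
      obtain rfl : l = k + 1 := by omega
      rfl
  have hS₁ : S 1 = n + 2 := by
    simp [hS, start, ids, elems, toks]
  refine ⟨wordOf N (fun p => letter (lab p)) (fun p => ι (dat p)), lab, ?_, fun p hp =>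
    hasLabel_wordOf (letter := fun p => letter (lab p)) (by simpa using hp)⟩
  have hsame : ∀ {p q}, p < N → q < N →
      (SameClass (wordOf N (fun p => letter (lab p)) (fun p => ι (dat p))) p q ↔ dat p = dat q) :=
    fun hp hq => (sameClass_wordOf hp hq).trans ι.injective.eq_iff
  constructor
  · have := hlab' (Nat.zero_le (ids r₀ n u 0).length)
    rw [show S 0 + 0 = 0 from rfl] at this
    rw [this]
    rfl
  · intro p hp
    rw [length_wordOf, hN] at hp
    have : S (u.length + 1) = S u.length + (ids r₀ n u u.length).length + 1 := rfl
    obtain rfl : p = S u.length + (ids r₀ n u u.length).length := by omega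
    rw [hlab' le_rfl]
    refine ⟨?_, ?_⟩
    · rw [Ne, ← Label.isSep_iff, isSep_labelAt]
      simp [ids]
    · obtain ⟨t, ht⟩ : ∃ t, u.length = t + 1 :=
        ⟨u.length - 1, by have := List.length_pos_iff.2 hu; omega⟩
      refine ⟨M.eval (u.take t), opAt r₀ u t, ?_, ?_⟩
      · rw [ht]
        rfl
      · have := nextState_op_labelAt (r₀ := r₀) (n := n) (M := M) (i := 0) (le_refl u.length)
        rw [List.take_length, ht] at this
        change M.step (M.eval (u.take t)) (opAt r₀ u t) = _ at this
        rw [this]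
        exact hacc
  · intro p hp
    rw [length_wordOf] at hp
    obtain ⟨k, i, hk, hi, rfl⟩ := hpos p (by omega)
    rcases hi.lt_or_eq with h | rfl
    · rw [hlab' hi, add_assoc, hlab' h]
      exact C.adj_labelAt hk h
    · rw [hlab' hi, show S k + (ids r₀ n u k).length + 1 = S (k + 1) + 0 from rfl,
        hlab' (Nat.zero_le _)]
      exact adj_labelAt_succ hk
  -- Equal names force different blocks `k < l` and exclude separators. The name at `q` is not
  -- fresh, so `q` is an incoming unit and its name also occurs in block `l - 1`. If `k < l - 1`,
  -- that occurrence would lie between `p` and its class successor `q`.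
  · rintro p q ⟨h₁, h₂, h₃⟩
    have hp := h₁.lt_length
    have hq := h₁.symm.lt_length
    rw [length_wordOf] at hp hq
    obtain ⟨k, i, hk, hi, rfl⟩ := hpos p hp
    obtain ⟨l, j, hl, hj, rfl⟩ := hpos q hq
    rw [hsame hp hq, hdat' hi, hdat' hj] at h₁
    rw [start_lt_iff hi hj] at h₂
    have hkl : k < l := by
      rcases h₂ with h₂ | ⟨rfl, h₂⟩
      · exact h₂
      · exact absurd (C.eq_of_idAt_eq hk hi hj h₁) h₂.ne
    have hi₀ : 0 < i := by
      by_contra h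
      obtain rfl : i = 0 := by omega
      cases j with
      | zero => exact hkl.ne (Sum.inl.inj h₁)
      | succ j => simp [idAt] at h₁
    have hj₀ : 0 < j := by
      by_contra h
      obtain rfl : j = 0 := by omega
      obtain ⟨a, -, ha⟩ := C.exists_idAt_eq hk hi₀ hi
      rw [ha] at h₁
      simp [idAt] at h₁
    obtain ⟨l, rfl⟩ : ∃ m, l = m + 1 := ⟨l - 1, by omega⟩
    obtain ⟨a, ha, hia⟩ := C.exists_idAt_eq hk hi₀ hi
    cases hm : (labelAt r₀ n u M (l + 1) j).inMark with
    | none =>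
      have := C.idAt_of_inMark_eq_none hl hj₀ hj hm
      rw [← h₁, hia, Sum.inr.injEq] at this
      omega
    | some r =>
      obtain ⟨b, hb, hjb⟩ := C.mem_toks_of_inMark hl hj hm
      obtain ⟨t, ht, -, htb⟩ := exists_outMark (M := M) hb
      rcases (show k ≤ l by omega).eq_or_lt with rfl | hkl'
      · exact hsep hi hj hj₀
      · have hlN := (hlt ht).2 (show l ≤ u.length by omega)
        refine absurd ?_ (h₃ (S l + t) ((start_lt_iff hi ht).2 (Or.inl hkl'))
          ((start_lt_iff ht hj).2 (Or.inl l.lt_succ_self)))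
        rw [hsame hp hlN, hdat' hi, hdat' ht, h₁, hjb, htb]
  · intro p hp r hr
    rw [length_wordOf] at *
    obtain ⟨k, i, hk, hi, rfl⟩ := hpos p hp
    rw [hlab' hi] at hr
    obtain ⟨a, ha, hia⟩ := mem_toks_of_outMark hi hr
    -- The last block has no outgoing unit, since no units are left at the end.
    have hk' : k < u.length := by
      refine lt_of_le_of_ne hk ?_
      rintro rfl
      simp [C.nil] at ha
    obtain ⟨j, hj, hm, hja⟩ := C.exists_inMark (M := M) hk' ha
    have hj₀ : 0 < j := by
      rcases Nat.eq_zero_or_pos j with rfl | h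
      · exact absurd (Label.isSep_of_inMark hm) (by simp [isSep_labelAt.2])
      · exact h
    have hq := (hlt hj).2 hk'
    refine ⟨S (k + 1) + j, hq, ⟨?_, hsep hi hj hj₀⟩, by rw [hlab' hj]; exact hm⟩
    rw [hsame hp hq, hdat' hi, hdat' hj, hia, hja]
  · intro q hq r hr
    rw [length_wordOf] at *
    obtain ⟨k, j, hk, hj, rfl⟩ := hpos q hq
    rw [hlab' hj] at hr
    cases k with
    | zero => simp [labelAt, Label.inMark_eq_some_iff] at hr
    | succ k =>
      obtain ⟨a, ha, hja⟩ := C.mem_toks_of_inMark hk hj hr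
      have hj₀ : 0 < j := by
        rcases Nat.eq_zero_or_pos j with rfl | h
        · exact absurd (Label.isSep_of_inMark hr) (by simp [isSep_labelAt.2])
        · exact h
      obtain ⟨i, hi, hm, hia⟩ := exists_outMark (M := M) ha
      have hp := (hlt hi).2 (show k ≤ u.length by omega)
      refine ⟨S k + i, hp, ⟨?_, hsep hi hj hj₀⟩, by rw [hlab' hi]; exact hm⟩
      rw [hsame hp hq, hdat' hi, hdat' hj, hia, hja]
  -- Block 1 starts at `n + 2` and lies in the word because `u` is not empty.
  · rw [length_wordOf, ← hS₁]
    exact (hlt (k := 1) (Nat.zero_le _)).2 (List.length_pos_iff.2 hu)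
  · have := hlab' (Nat.zero_le (ids r₀ n u 1).length)
    rw [Nat.add_zero, hS₁] at this
    rw [this]
    simp [labelAt]
  · intro p hp
    obtain ⟨⟨k, i⟩, hi, rfl⟩ := exists_start r₀ n u p
    rw [hlab' hi]
    rw [← hS₁, ← Nat.add_zero (S 1), hS, start_lt_iff hi (Nat.zero_le _)] at hp
    obtain rfl : k = 0 := by simp only at hp; omega
    rfl

end Completeness

/-! ### The formula for encodings -/

section Sentence

variable {A D : Type*} {m : ℕ}

/-- Satisfiability is undecidable if for words with two kinds of letters at separators, which
alternate, there is a definable predicate that says that two positions of the same class have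
exactly one separator between them. -/
theorem not_isDecidable_of_oneSep [Encodable A] [Infinite D] {F : Fin m → Language A}
    (letter : Bool → Bool → A) (Nxt : List (A × D) → ℕ → ℕ → Prop)
    (hdef : ∀ n, Definable F fun w (_ : Fin n → Set ℕ) x y => Nxt w x y)
    (hNxt : ∀ (w : List (A × D)) (par sep : ℕ → Bool),
      (∀ p < w.length, HasLabel w (letter (par p) (sep p)) p) →
      (∀ p, p + 1 < w.length → par (p + 1) = (par p ^^ sep (p + 1))) →
      ∀ p q, Nxt w p q ↔ SameClass w p q ∧ OneSep sep p q) :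
    ¬ EMSO2.IsDecidable fun ψ : EMSO2 A m => ψ.Satisfiable D F := by
  obtain ⟨K, r₀, L, ⟨Q, _, M, rfl⟩, hnil, hund⟩ := exists_language_undecidable
  -- One set variable for each label.
  let e : Label Q (Fin K) ≃ Fin (Nat.card (Label Q (Fin K))) := Finite.equivFin _
  have hX : ∀ S : Label Q (Fin K) → Prop, Definable F
      fun (_ : List (A × D)) (X : Fin (Nat.card (Label Q (Fin K))) → Set ℕ) x _ =>
        ∃ l, S l ∧ x ∈ X (e l) :=
    fun S => .exists_finite fun l => (Definable.const _).and (.memX _)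
  have hY : ∀ S : Label Q (Fin K) → Prop, Definable F
      fun (_ : List (A × D)) (X : Fin (Nat.card (Label Q (Fin K))) → Set ℕ) _ y =>
        ∃ l, S l ∧ y ∈ X (e l) :=
    fun S => .exists_finite fun l => (Definable.const _).and (.memY _)
  -- `d₁` says that each position has exactly one label, compatible with its letter; the others
  -- translate the fields of `Valid`. Only `d₈` depends on the free variable `x`, which stands for
  -- the position `n + 2`.
  have d₁ := (Definable.exists_finite (ι := Label Q (Fin K)) fun l =>
    ((Definable.memX (A := A) (D := D) (F := F) (e l)).and (Definable.forall_finite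
      (ι := Label Q (Fin K)) fun l' => (Definable.const (l' ≠ l)).imp (Definable.memX (e l')).not)).and
        (.letterX (letter l.par l.isSep))).allX
  have d₂ := ((Definable.gt (A := A) (D := D) (F := F)).exY.not.imp
    (.memX (e ⟨true, none, .sep⟩))).allX
  have d₃ := ((Definable.lt (A := A) (D := D) (F := F)).exY.not.imp (hX fun l => l.kind ≠ .sep ∧
    ∃ q i, l.op = some (q, i) ∧ M.step q i ∈ M.accept)).allX
  have d₄ := ((Definable.succ (A := A) (D := D) (F := F)).imp (.exists_finite fun l =>
    .exists_finite fun l' => (Definable.const (l.Adj M r₀ l')).and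
      ((Definable.memX (e l)).and (.memY (e l'))))).allY.allX
  have d₅ := (Definable.classSucc.imp (hdef (Nat.card (Label Q (Fin K))))).allY.allX
  have d₆ := (Definable.forall_finite fun r : Fin K => (hX fun l => l.outMark = some r).imp
    ((hdef _).and (hY fun l => l.inMark = some r)).exY).allX
  have d₇ := (Definable.forall_finite fun r : Fin K => (hY fun l => l.inMark = some r).imp
    ((hdef _).and (hX fun l => l.outMark = some r)).exX).allY
  have d₈ := (hX fun l => l.op ≠ none).and (Definable.gt.imp (hY fun l => l.op = none)).allY
  refine not_isDecidable_satisfiable hund (Θ := fun w X x =>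
      (∀ p < w.length, ∃ l, (p ∈ X (e l) ∧ ∀ l', l' ≠ l → p ∉ X (e l')) ∧
        HasLabel w (letter l.par l.isSep) p) ∧
      (∀ p < w.length, (¬ ∃ q < w.length, q < p) → p ∈ X (e ⟨true, none, .sep⟩)) ∧
      (∀ p < w.length, (¬ ∃ q < w.length, p < q) → ∃ l, (l.kind ≠ .sep ∧
        ∃ q i, l.op = some (q, i) ∧ M.step q i ∈ M.accept) ∧ p ∈ X (e l)) ∧
      (∀ p < w.length, ∀ q < w.length, q = p + 1 → ∃ l l', l.Adj M r₀ l' ∧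
        p ∈ X (e l) ∧ q ∈ X (e l')) ∧
      (∀ p < w.length, ∀ q < w.length, ClassSucc w p q → Nxt w p q) ∧
      (∀ p < w.length, ∀ r, (∃ l, l.outMark = some r ∧ p ∈ X (e l)) →
        ∃ q < w.length, Nxt w p q ∧ ∃ l, l.inMark = some r ∧ q ∈ X (e l)) ∧
      (∀ q < w.length, ∀ r, (∃ l, l.inMark = some r ∧ q ∈ X (e l)) →
        ∃ p < w.length, Nxt w p q ∧ ∃ l, l.outMark = some r ∧ p ∈ X (e l)) ∧
      (∃ l, l.op ≠ none ∧ x ∈ X (e l)) ∧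
      ∀ q < w.length, q < x → ∃ l, l.op = none ∧ q ∈ X (e l))
    (d₁.and (d₂.and (d₃.and (d₄.and (d₅.and (d₆.and (d₇.and d₈))))))) fun n => ?_
  constructor
  · rintro ⟨u, hu, hex⟩
    obtain ⟨w, lab, V, hlab⟩ := exists_valid (D := D) (fun l => letter l.par l.isSep)
      (by rintro rfl; exact hnil hu) hu hex
    have hn := hNxt w _ _ hlab fun p hp => by
      have h := V.adj p hp
      cases hs : (lab (p + 1)).isSep with
      | false => simp [(h.same hs).1]
      | true => simp [(h.sep hs).1]
    have hmem : ∀ {p l}, p < w.length → (p ∈ {p | p < w.length ∧ lab p = e.symm (e l)} ↔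
        lab p = l) := fun hp => by simp [hp]
    have hself : ∀ {p}, p < w.length → p ∈ {q | q < w.length ∧ lab q = e.symm (e (lab p))} :=
      fun hp => (hmem hp).2 rfl
    refine ⟨w, fun i => {p | p < w.length ∧ lab p = e.symm i}, fun i p hp => hp.1, V.lt,
      ?_, ?_, ?_, ?_, ?_, ?_, ?_, ?_, ?_⟩
    · intro p hp
      exact ⟨lab p, ⟨hself hp, fun l' hl' h => hl' ((hmem hp).1 h).symm⟩, hlab p hp⟩
    · intro p hp h
      obtain rfl : p = 0 := by
        by_contra h0
        exact h ⟨0, by omega, by omega⟩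
      exact (hmem hp).2 V.first
    · intro p hp h
      refine ⟨lab p, V.last p ?_, hself hp⟩
      by_contra h'
      exact h ⟨p + 1, by omega, by omega⟩
    · rintro p hp q hq rfl
      exact ⟨lab p, lab (p + 1), V.adj p hq, hself hp, hself hq⟩
    · intro p hp q hq h
      exact (hn p q).2 ⟨h.1, V.class_succ p q h⟩
    · rintro p hp r ⟨l, hl, hpl⟩
      obtain rfl := (hmem hp).1 hpl
      obtain ⟨q, hq, h, hin⟩ := V.out p hp r hl
      exact ⟨q, hq, (hn p q).2 h, lab q, hin, hself hq⟩
    · rintro q hq r ⟨l, hl, hql⟩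
      obtain rfl := (hmem hq).1 hql
      obtain ⟨p, hp, h, hout⟩ := V.in' q hq r hl
      exact ⟨p, hp, (hn p q).2 h, lab p, hout, hself hp⟩
    · exact ⟨lab (n + 2), V.init, hself V.lt⟩
    · intro q hq hqn
      exact ⟨lab q, V.before q hqn, hself hq⟩
  · rintro ⟨w, X, -, hlt, h₁, h₂, h₃, h₄, h₅, h₆, h₇, h₈, h₉⟩
    have : Nonempty (Label Q (Fin K)) := ⟨⟨true, none, .sep⟩⟩
    choose! lab hlab using h₁
    have hmem : ∀ {p l}, p < w.length → p ∈ X (e l) → l = lab p := fun hp h => by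
      by_contra hne
      exact (hlab _ hp).1.2 _ hne h
    have hadj : ∀ p, p + 1 < w.length → (lab p).Adj M r₀ (lab (p + 1)) := by
      intro p hp
      obtain ⟨l, l', h, hl, hl'⟩ := h₄ p (by omega) (p + 1) hp rfl
      rwa [hmem (by omega) hl, hmem hp hl'] at h
    have hn := hNxt w _ _ (fun p hp => (hlab p hp).2) fun p hp => by
      have h := hadj p hp
      cases hs : (lab (p + 1)).isSep with
      | false => simp [(h.same hs).1]
      | true => simp [(h.sep hs).1]
    have V : Valid M r₀ n w lab := by
      refine ⟨?_, ?_, hadj, ?_, ?_, ?_, hlt, ?_, ?_⟩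
      · exact (hmem (by omega) (h₂ 0 (by omega) (by simp))).symm
      · intro p hp
        obtain ⟨l, hl, hpl⟩ := h₃ p (by omega) (by rintro ⟨q, hq, hpq⟩; omega)
        rwa [hmem (by omega) hpl] at hl
      · intro p q h
        exact ((hn p q).1 (h₅ p h.1.lt_length q h.1.symm.lt_length h)).2
      · intro p hp r hr
        obtain ⟨q, hq, hpq, l, hl, hql⟩ := h₆ p hp r ⟨_, hr, (hlab p hp).1.1⟩
        exact ⟨q, hq, (hn p q).1 hpq, hmem hq hql ▸ hl⟩
      · intro q hq r hr
        obtain ⟨p, hp, hpq, l, hl, hpl⟩ := h₇ q hq r ⟨_, hr, (hlab q hq).1.1⟩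
        exact ⟨p, hp, (hn p q).1 hpq, hmem hp hpl ▸ hl⟩
      · obtain ⟨l, hl, hnl⟩ := h₈
        exact hmem hlt hnl ▸ hl
      · intro p hp
        obtain ⟨l, hl, hpl⟩ := h₉ p (by omega) hp
        exact hmem (by omega) hpl ▸ hl
    exact V.run

end Sentence

/-! ### The languages -/

section Languages

open scoped Computability

variable {A D : Type*} {a : A} {w : List (A × D)} {i j : ℕ}

theorem mem_kstar_letters {S : Set A} {u : List A} : u ∈ (letters S)∗ ↔ ∀ c ∈ u, c ∈ S := by
  constructor
  · rintro ⟨T, rfl, hT⟩ c hc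
    obtain ⟨v, hv, hcv⟩ := List.mem_flatten.1 hc
    obtain ⟨d, hd, rfl⟩ := hT v hv
    rwa [List.mem_singleton.1 hcv]
  · intro h
    refine ⟨u.map fun c => [c], (by clear h; induction u with | nil => rfl | cons c u ih => simpa using ih), fun v hv => ?_⟩
    obtain ⟨c, hc, rfl⟩ := List.mem_map.1 hv
    exact ⟨c, h c hc, rfl⟩

theorem mem_kstar_mul_letter_mul {S : Set A} {u : List A} :
    u ∈ (letters S)∗ * letters {a} * (letters S)∗ ↔
      ∃ l r, u = l ++ a :: r ∧ (∀ c ∈ l, c ∈ S) ∧ ∀ c ∈ r, c ∈ S := by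
  constructor
  · rintro ⟨_, ⟨l, hl, _, ⟨_, rfl, rfl⟩, rfl⟩, r, hr, rfl⟩
    exact ⟨l, r, by simp, mem_kstar_letters.1 hl, mem_kstar_letters.1 hr⟩
  · rintro ⟨l, r, rfl, hl, hr⟩
    exact ⟨l ++ [a], ⟨l, mem_kstar_letters.2 hl, [a], ⟨a, rfl, rfl⟩, rfl⟩, r,
      mem_kstar_letters.2 hr, by simp⟩

theorem mem_withLetter {u : List A} : u ∈ withLetter a ↔ a ∈ u := by
  rw [withLetter, mem_kstar_mul_letter_mul, List.mem_iff_append]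
  simp

theorem mem_withLetterOnce {u : List A} : u ∈ withLetterOnce a ↔ ∃! t : ℕ, u[t]? = some a := by
  rw [withLetterOnce, mem_kstar_mul_letter_mul]
  simp only [Set.mem_compl_iff, Set.mem_singleton_iff]
  constructor
  · rintro ⟨l, r, rfl, hl, hr⟩
    refine ⟨l.length, by simp, fun t (ht : (l ++ a :: r)[t]? = some a) => ?_⟩
    rcases lt_trichotomy t l.length with h | h | h
    · rw [List.getElem?_append_left h] at ht
      exact absurd rfl (hl a (List.mem_of_getElem? ht))
    · exact h
    · obtain ⟨s, rfl⟩ : ∃ s, t = l.length + (s + 1) := ⟨t - l.length - 1, by omega⟩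
      rw [List.getElem?_append_right (by omega), Nat.add_sub_cancel_left,
        List.getElem?_cons_succ] at ht
      exact absurd rfl (hr a (List.mem_of_getElem? ht))
  · rintro ⟨t, ht, huniq⟩
    obtain ⟨hlt, rfl⟩ := List.getElem?_eq_some_iff.1 ht
    refine ⟨u.take t, u.drop (t + 1), by simp, ?_, ?_⟩
    · rintro c hc rfl
      obtain ⟨s, hs⟩ := List.getElem?_of_mem hc
      rw [List.getElem?_take] at hs
      split_ifs at hs with hst
      exact hst.ne (huniq s hs)
    · rintro c hc rfl
      obtain ⟨s, hs⟩ := List.getElem?_of_mem hc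
      rw [List.getElem?_drop] at hs
      have := huniq _ hs
      omega

theorem getElem?_factor {t : ℕ} :
    (factor w i j)[t]? = some a ↔ i + 1 + t < j ∧ HasLabel w a (i + 1 + t) := by
  rw [factor, List.getElem?_map, List.getElem?_drop, List.getElem?_take, HasLabel]
  split_ifs with h <;> simp [h]

theorem factor_mem_withLetter :
    factor w i j ∈ withLetter a ↔ ∃ k, i < k ∧ k < j ∧ HasLabel w a k := by
  rw [mem_withLetter, List.mem_iff_getElem?]
  simp only [getElem?_factor]
  constructor
  · rintro ⟨t, h₁, h₂⟩
    exact ⟨_, by omega, h₁, h₂⟩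
  · rintro ⟨k, h₁, h₂, h₃⟩
    obtain ⟨t, rfl⟩ : ∃ t, k = i + 1 + t := ⟨k - (i + 1), by omega⟩
    exact ⟨t, h₂, h₃⟩

theorem factor_mem_withLetterOnce :
    factor w i j ∈ withLetterOnce a ↔ ∃! k, i < k ∧ k < j ∧ HasLabel w a k := by
  rw [mem_withLetterOnce]
  simp only [getElem?_factor]
  constructor
  · rintro ⟨t, ⟨h₁, h₂⟩, h₃⟩
    refine ⟨i + 1 + t, ⟨by omega, h₁, h₂⟩, ?_⟩
    rintro k ⟨hk₁, hk₂, hk₃⟩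
    obtain ⟨s, rfl⟩ : ∃ s, k = i + 1 + s := ⟨k - (i + 1), by omega⟩
    rw [h₃ s ⟨hk₂, hk₃⟩]
  · rintro ⟨k, ⟨h₁, h₂, h₃⟩, h₄⟩
    obtain ⟨t, rfl⟩ : ∃ t, k = i + 1 + t := ⟨k - (i + 1), by omega⟩
    refine ⟨t, ⟨h₂, h₃⟩, ?_⟩
    rintro s ⟨hs₁, hs₂⟩
    have := h₄ (i + 1 + s) ⟨by omega, hs₁, hs₂⟩
    omega

theorem HasLabel.eq {b : A} (h : HasLabel w a i) (h' : HasLabel w b i) : a = b :=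
  Option.some.inj (h.symm.trans h')

/-- If the parity changes exactly at the separators, then two separators of the same parity have a
separator of the other parity between them. -/
theorem exists_sep_between {par sep : ℕ → Bool} {p q : ℕ} (hpq : p < q)
    (hpar : ∀ k, p ≤ k → k < q → par (k + 1) = (par k ^^ sep (k + 1))) (hq : sep q = true)
    (h : par p = par q) : ∃ k, p < k ∧ k < q ∧ sep k = true ∧ par k ≠ par p := by
  -- Otherwise the parity is constant from `p` up to `q - 1` and flips at `q`, contrary to `h`.
  by_contra! hno
  have hconst : ∀ k, p ≤ k → k < q → par k = par p := by
    intro k hk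
    induction k, hk using Nat.le_induction with
    | base => exact fun _ => rfl
    | succ k hk ih =>
      intro hkq
      cases hs : sep (k + 1) with
      | false => rw [hpar k hk (by omega), hs, Bool.xor_false, ih (by omega)]
      | true => exact hno (k + 1) (by omega) hkq hs
  obtain ⟨q, rfl⟩ : ∃ t, q = t + 1 := ⟨q - 1, by omega⟩
  rw [hpar q (by omega) (by omega), hq, hconst q (by omega) (by omega)] at h
  simp at h

end Languages

/-- With `a` at the separators and `b` elsewhere, the guarded predicate itself counts separators;
the parity is not needed in the letters. -/
theorem not_isDecidable_withLetterOnce {A : Type*} [Encodable A] {D : Type*} [Infinite D] {a b : A}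
    (hab : b ≠ a) :
    ¬ EMSO2.IsDecidable fun ψ : EMSO2 A 1 => ψ.Satisfiable D ![withLetterOnce a] := by
  refine not_isDecidable_of_oneSep (fun _ s => if s then a else b)
    (fun w x y => GuardedPred w (withLetterOnce a) x y)
    (fun n => Definable.guarded (F := ![withLetterOnce a]) 0) ?_
  intro w par sep hw _ p q
  rw [GuardedPred, RegPred, factor_mem_withLetterOnce, OneSep]
  refine and_congr_right fun hs => and_congr_right fun _ => existsUnique_congr fun k =>
    and_congr_right fun _ => and_congr_right fun hkq => ?_
  have := hw k (hkq.trans hs.symm.lt_length)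
  cases hk : sep k with
  | false =>
    rw [hk] at this
    simp only [Bool.false_eq_true, iff_false]
    exact fun h => hab (this.eq h)
  | true =>
    rw [hk] at this
    simpa using this

/-- Separators carry `a` or `b` according to parity, other positions carry `c`. No separator in
between means neither letter occurs, and at least two mean both occur, so the exclusive disjunction
expresses exactly one. -/
theorem not_isDecidable_withLetter {A : Type*} [Encodable A] {D : Type*} [Infinite D] {a b c : A}
    (hab : a ≠ b) (hca : c ≠ a) (hcb : c ≠ b) :
    ¬ EMSO2.IsDecidable fun ψ : EMSO2 A 2 => ψ.Satisfiable D ![withLetter a, withLetter b] := by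
  refine not_isDecidable_of_oneSep (fun t s => if s then (if t then a else b) else c)
    (fun w x y => (GuardedPred w (withLetter a) x y ∧ ¬ GuardedPred w (withLetter b) x y) ∨
      (¬ GuardedPred w (withLetter a) x y ∧ GuardedPred w (withLetter b) x y))
    (fun n => ?_) ?_
  · have ha := Definable.guarded (D := D) (n := n) (F := ![withLetter a, withLetter b]) 0
    have hb := Definable.guarded (D := D) (n := n) (F := ![withLetter a, withLetter b]) 1
    exact (ha.and hb.not).or (ha.not.and hb)
  intro w par sep hw hpar p q
  have hlabel : ∀ k < w.length, (HasLabel w a k ↔ sep k = true ∧ par k = true) ∧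
      (HasLabel w b k ↔ sep k = true ∧ par k = false) := by
    intro k hk
    have := hw k hk
    cases hs : sep k <;> cases ht : par k <;> rw [hs, ht] at this <;>
      simp only [if_true, if_false, Bool.false_eq_true] at this
    · exact ⟨by simpa using fun h => hca (this.eq h), by simpa using fun h => hcb (this.eq h)⟩
    · exact ⟨by simpa using fun h => hca (this.eq h), by simpa using fun h => hcb (this.eq h)⟩
    · exact ⟨by simpa using fun h => hab (HasLabel.eq h this), by simpa using this⟩
    · exact ⟨by simpa using this, by simpa using fun h => hab (this.eq h)⟩
  by_cases hs : SameClass w p q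
  swap
  · simp [GuardedPred, hs]
  by_cases hpq : p < q
  swap
  · simp [GuardedPred, RegPred, OneSep, hpq]
  have hq := hs.symm.lt_length
  have hA : GuardedPred w (withLetter a) p q ↔ ∃ k, p < k ∧ k < q ∧ sep k = true ∧ par k = true := by
    rw [GuardedPred, RegPred, factor_mem_withLetter, and_iff_right hs, and_iff_right hpq]
    exact exists_congr fun k => and_congr_right fun _ => and_congr_right fun hk =>
      (hlabel k (hk.trans hq)).1
  have hB : GuardedPred w (withLetter b) p q ↔ ∃ k, p < k ∧ k < q ∧ sep k = true ∧ par k = false := by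
    rw [GuardedPred, RegPred, factor_mem_withLetter, and_iff_right hs, and_iff_right hpq]
    exact exists_congr fun k => and_congr_right fun _ => and_congr_right fun hk =>
      (hlabel k (hk.trans hq)).2
  rw [hA, hB, OneSep, and_iff_right hs, and_iff_right hpq]
  -- If all separators in between have parity `t`, there cannot be two: `exists_sep_between` would
  -- supply one of the other parity.
  have huniq : ∀ t : Bool, (∃ k, p < k ∧ k < q ∧ sep k = true ∧ par k = t) →
      (¬ ∃ k, p < k ∧ k < q ∧ sep k = true ∧ par k = !t) → ∃! k, p < k ∧ k < q ∧ sep k = true := by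
    rintro t ⟨k, h₁, h₂, h₃, h₄⟩ hno
    have hpar' : ∀ l, p < l → l < q → sep l = true → par l = t := fun l hl hl' hl'' => by
      by_contra h
      exact hno ⟨l, hl, hl', hl'', Bool.eq_not.2 h⟩
    have key : ∀ k l, p < k → k < l → l < q → sep k = true → sep l = true → False := by
      intro k l hk hkl hl hsk hsl
      obtain ⟨j, hj₁, hj₂, hj₃, hj₄⟩ := exists_sep_between hkl
        (fun i _ hi => hpar i (by omega)) hsl
        ((hpar' k hk (by omega) hsk).trans (hpar' l (by omega) hl hsl).symm)
      exact hj₄ ((hpar' j (by omega) (by omega) hj₃).trans (hpar' k hk (by omega) hsk).symm)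
    refine ⟨k, ⟨h₁, h₂, h₃⟩, ?_⟩
    rintro l ⟨hl₁, hl₂, hl₃⟩
    rcases lt_trichotomy l k with h | h | h
    · exact (key l k hl₁ h h₂ hl₃ h₃).elim
    · exact h
    · exact (key k l h₁ h hl₂ h₃ hl₃).elim
  constructor
  · rintro (⟨h, h'⟩ | ⟨h', h⟩)
    · exact huniq true h h'
    · exact huniq false h h'
  · rintro ⟨k, ⟨h₁, h₂, h₃⟩, hu⟩
    cases hk : par k with
    | true =>
      refine Or.inl ⟨⟨k, h₁, h₂, h₃, hk⟩, ?_⟩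
      rintro ⟨l, h₁', h₂', h₃', h₄'⟩
      rw [hu l ⟨h₁', h₂', h₃'⟩, hk] at h₄'
      cases h₄'
    | false =>
      refine Or.inr ⟨?_, ⟨k, h₁, h₂, h₃, hk⟩⟩
      rintro ⟨l, h₁', h₂', h₃', h₄'⟩
      rw [hu l ⟨h₁', h₂', h₃'⟩, hk] at h₄'
      cases h₄'

end DataWord

theorem mainTheorem4 {A : Type*} [Finite A] [Encodable A] {D : Type*} [Infinite D] :
    (∀ a b : A, a ≠ b → (∃ c : A, c ≠ a ∧ c ≠ b) →
      ¬ DataWord.EMSO2.IsDecidable (fun ψ : DataWord.EMSO2 A 2 =>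
        ψ.Satisfiable D ![DataWord.withLetter a, DataWord.withLetter b])) ∧
    (∀ a : A, (∃ b : A, b ≠ a) →
      ¬ DataWord.EMSO2.IsDecidable (fun ψ : DataWord.EMSO2 A 1 =>
        ψ.Satisfiable D ![DataWord.withLetterOnce a])) := by
  refine ⟨?_, ?_⟩
  · rintro a b hab ⟨c, hca, hcb⟩
    exact DataWord.not_isDecidable_withLetter hab hca hcb
  · rintro a ⟨b, hab⟩
    exact DataWord.not_isDecidable_withLetterOnce hab
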